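/- Fix $\lambda_p>0$, $d>0$, $0<R_{\mathrm{tx}}<R_{\mathrm{cs}}$, $P_t>0$ and a measurable path-loss function $l\ge 0$ on $[0,\infty)$. Let $\{(X_i,\theta_i)\}$ be an independently marked homogeneous Poisson point process on $\mathbb{R}^2$ of intensity $\lambda_p$, with marks $\theta_i$ uniform on $[0,2\pi]$ (transmitter $X_i$ has its receiver at $X_i+d(\cos\theta_i,\sin\theta_i)$). The exclusion zone of a pair with transmitter $x$ and orientation $\theta$ is $B_x(R_{\mathrm{cs}})\cup B_{x+(d\cos\theta,d\sin\theta)}(R_{\mathrm{tx}})$ (closed discs). Type I thinning retains the pair $(X_i,\theta_i)$ if and only if no $X_j$ with $j\ne i$ lies in its exclusion zone; let $\widetilde\Phi$ be the process of retained pairs. Then the retained transmitters have a finite intensity $\lambda>0$ (mean number per unit area). Let the reduced Palm distributions $P^!_{(o,\theta)}$, $\theta\in[0,2\pi]$, of $\widetilde\Phi$ be the probability measures on configurations, depending measurably on $\theta$, with $$E\,\#\{(x,\theta)\in\widetilde\Phi:\ x\in B,\ \theta\in L,\ (\widetilde\Phi\setminus\{(x,\theta)\})-x\in Y\}=\frac{\lambda|B|}{2\pi}\int_L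 P^!_{(o,\theta)}(Y)\,d\theta$$ for all Borel $B\subset\mathbb{R}^2$, $L\subset[0,2\pi]$ and measurable sets $Y$ of configurations (translation acts on positions only). Such a family exists, and it can be chosen rotation covariant: for $\theta\in[0,2\pi)$, $P^!_{(o,\theta)}$ is the image of $P^!_{(o,0)}$ under rotation by $\theta$ of positions and (modulo $2\pi$) orientations. For every rotation covariant family, the mean interference at the receiver $z_o=(d,0)$ of a typical pair $(o,0)$ is $$E^!_{(o,0)}\Big(\sum_{(x,\theta)\in\widetilde\Phi}P_t\,l(|x-z_o|)\Big)=\frac{\lambda_p^2P_t}{2\pi\lambda}\int_0^\infty\!\!\int_0^{2\pi}\!\!\int_0^{2\pi} l\big(\sqrt{r^2-2rd\cos\varphi+d^2}\big)\,k(r,\varphi,0,\theta)\,r\,d\theta\,d\varphi\,dr ,$$ as an identity in $[0,\infty]$. The same value is obtained for $E^!_{(o,\theta_o)}\big(\sum_{(x,\theta)\in\widetilde\Phi} P_t\,l(|x-z_o|)\big)$, now with $z_o=(d\cos\theta_o,d\sin\theta_o)$, at every $\theta_o\in[0,2\pi)$ for a rotation covariant family, and at almost every $\theta_o\in[0,2\pi]$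 for an arbitrary family of reduced Palm distributions. Here $k(r,\varphi,0,\theta)=0$ if $(r,\varphi,\theta)\in S_1\cup S_2\cup S_3$ and $k(r,\varphi,0,\theta)=\exp(-\lambda_pV(r,\varphi,\theta))$ otherwise, where $S_1=\{r\le R_{\mathrm{cs}}\}$, $S_2=\{r^2-2rd\cos\varphi+d^2\le R_{\mathrm{tx}}^2\}$, $S_3=\{r^2+2rd\cos(\varphi-\theta)+d^2\le R_{\mathrm{tx}}^2\}$, and $V(r,\varphi,\theta)$ is the area of the union of the exclusion zones of two pairs whose transmitters are at the origin and at polar coordinates $(r,\varphi)$, with orientations $0$ and $\theta$ respectively. -/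

import Mathlib

open MeasureTheory ProbabilityTheory Set
open scoped ENNReal NNReal

noncomputable section

namespace RtsCts

/-- The Euclidean plane. -/
abbrev Plane : Type := EuclideanSpace ℝ (Fin 2)

/-- A configuration of marked points (position, orientation), seen as a counting measure. The
space of configurations carries the sigma-algebra generated by the evaluations `μ ↦ μ A`. -/
abbrev Config : Type := Measure (Plane × ℝ)

/-- The point with polar coordinates `(r, φ)`. -/
def polar (r φ : ℝ) : Plane := !₂[r * Real.cos φ, r * Real.sin φ]

/-- Position of the receiver of a transmitter located at `x` with orientation `θ`. -/
def receiver (d : ℝ) (x : Plane) (θ : ℝ) : Plane := x + polar d θ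

/-- Exclusion zone of the pair whose transmitter is at `x` and whose receiver has
orientation `θ`. -/
def zone (d Rcs Rtx : ℝ) (x : Plane) (θ : ℝ) : Set Plane :=
  Metric.closedBall x Rcs ∪ Metric.closedBall (receiver d x θ) Rtx

/-! ### The Poisson bipolar process -/

/-- The points `X i` form a homogeneous Poisson point process of intensity `lamp` on the plane. -/
structure IsPoissonProcess {Ω : Type*} [MeasurableSpace Ω] (P : Measure Ω) (lamp : ℝ)
    (X : ℕ → Ω → Plane) : Prop where
  measurable : ∀ i, Measurable (X i)
  /-- Numbers of points are Poisson distributed. -/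
  hasLaw_count : ∀ B : Set Plane, MeasurableSet B → volume B < ∞ →
    HasLaw (fun ω => Measure.sum (fun i => Measure.dirac (X i ω)) B)
      ((poissonMeasure (ENNReal.ofReal lamp * volume B).toNNReal).map (Nat.cast : ℕ → ℝ≥0∞)) P
  /-- Numbers of points in disjoint sets are independent. -/
  indep_count : ∀ (n : ℕ) (B : Fin n → Set Plane), (∀ k, MeasurableSet (B k)) →
    (∀ k, volume (B k) < ∞) → Pairwise (fun k m => Disjoint (B k) (B m)) →
    iIndepFun (fun k ω => Measure.sum (fun i => Measure.dirac (X i ω)) (B k)) P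

/-- The points `(X i, Θ i)` form an independently marked Poisson process of intensity `lamp`, with
marks uniform on `[0, 2π]`. -/
structure IsPoissonBipolar {Ω : Type*} [MeasurableSpace Ω] (P : Measure Ω) (lamp : ℝ)
    (X : ℕ → Ω → Plane) (Θ : ℕ → Ω → ℝ) : Prop where
  poisson : IsPoissonProcess P lamp X
  measurable_mark : ∀ i, Measurable (Θ i)
  uniform_mark : ∀ i, pdf.IsUniform (Θ i) (Icc 0 (2 * Real.pi)) P volume
  indep_mark : iIndepFun Θ P
  indep_points_marks : IndepFun (fun ω i => X i ω) (fun ω i => Θ i ω) P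

/-! ### Type I thinning -/

/-- Indices of the neighbours of the pair `i`: the other transmitters in its exclusion zone. -/
def neighbors (d Rcs Rtx : ℝ) (x : ℕ → Plane) (t : ℕ → ℝ) (i : ℕ) : Set ℕ :=
  {j | x j ∈ zone d Rcs Rtx (x i) (t i) ∧ j ≠ i}

/-- The medium access indicator of the pair `i` equals one. -/
def Retained (d Rcs Rtx : ℝ) (x : ℕ → Plane) (t : ℕ → ℝ) (i : ℕ) : Prop :=
  (neighbors d Rcs Rtx x t i).encard = 0

open Classical in
/-- The process of retained transceiver pairs. -/
def thinned {Ω : Type*} (d Rcs Rtx : ℝ) (X : ℕ → Ω → Plane) (Θ : ℕ → Ω → ℝ) (ω : Ω) : Config :=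
  Measure.sum fun i =>
    if Retained d Rcs Rtx (fun j => X j ω) (fun j => Θ j ω) i then
      Measure.dirac (X i ω, Θ i ω) else 0

/-! ### Intensity, Palm distributions, interference -/

/-- `lam` is the intensity of the (unmarked) points of `Ψ`: the mean number of points per unit
area. -/
def HasIntensity {Ω : Type*} [MeasurableSpace Ω] (P : Measure Ω) (Ψ : Ω → Config)
    (lam : ℝ) : Prop :=
  ∀ B : Set Plane, MeasurableSet B →
    ∫⁻ ω, Ψ ω (B ×ˢ univ) ∂P = ENNReal.ofReal lam * volume B

/-- The configuration `μ` without its point `p`, translated so that `p` sits at the origin. -/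
def seenFrom (p : Plane × ℝ) (μ : Config) : Config :=
  (μ.restrict {p}ᶜ).map fun q => (q.1 - p.1, q.2)

/-- `Q θ` is, for each mark `θ`, the reduced Palm distribution at `(o, θ)` of the stationary marked
process `Ψ` with intensity `lam` and marks uniform on `[0, 2π]`: the mean number of points located
in `B`, with mark in `L`, from which the rest of the process is seen in `Y`, equals
`lam * |B| * (1 / 2π) * ∫_L Q θ Y dθ`. -/
def IsReducedPalm {Ω : Type*} [MeasurableSpace Ω] (P : Measure Ω) (Ψ : Ω → Config)
    (lam : ℝ) (Q : Kernel ℝ Config) : Prop :=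
  IsMarkovKernel Q ∧
  ∀ (B : Set Plane) (L : Set ℝ) (Y : Set Config),
    MeasurableSet B → MeasurableSet L → MeasurableSet Y →
    ∫⁻ ω, Ψ ω {p | p.1 ∈ B ∧ p.2 ∈ L ∧ seenFrom p (Ψ ω) ∈ Y} ∂P =
      ENNReal.ofReal (lam / (2 * Real.pi)) * volume B *
        ∫⁻ θ in L ∩ Icc 0 (2 * Real.pi), Q θ Y

/-- Rotation of a transceiver pair about the origin by the angle `α`; orientations are taken
modulo `2π`. -/
def rotatePair (α : ℝ) (p : Plane × ℝ) : Plane × ℝ :=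
  (!₂[Real.cos α * p.1 0 - Real.sin α * p.1 1, Real.sin α * p.1 0 + Real.cos α * p.1 1],
    toIcoMod Real.two_pi_pos 0 (p.2 + α))

/-- The version `Q` of the Palm distributions respects rotations: what is seen from a pair with
orientation `θ` is what is seen from a pair with orientation `0`, rotated by `θ`. -/
def RotationCovariant (Q : Kernel ℝ Config) : Prop :=
  ∀ θ ∈ Ico 0 (2 * Real.pi), Q θ = (Q 0).map fun μ : Config => μ.map (rotatePair θ)

/-- Interference created at `z` by the transmitters of `μ`, with transmit power `Pt` and path-loss
function `l`. -/
def interference (Pt : ℝ) (l : ℝ → ℝ) (z : Plane) (μ : Config) : ℝ≥0∞ :=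
  ∫⁻ p, ENNReal.ofReal (Pt * l (dist p.1 z)) ∂μ

/-- Mean interference at the receiver of the typical pair `(o, θ)` under the Palm distribution
at `(o, θ)`. -/
def meanInterference (d Pt : ℝ) (l : ℝ → ℝ) (Q : Kernel ℝ Config) (θ : ℝ) : ℝ≥0∞ :=
  ∫⁻ μ, interference Pt l (receiver d 0 θ) μ ∂(Q θ)

/-! ### The closed formula -/

/-- Area of the union of the exclusion zones of two pairs, with transmitters at the origin and at
polar coordinates `(r, φ)`, and orientations `0` and `θ`. -/
def unionArea (d Rcs Rtx r φ θ : ℝ) : ℝ :=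
  volume.real (zone d Rcs Rtx 0 0 ∪ zone d Rcs Rtx (polar r φ) θ)

/-- The transmitters are in each other's carrier sensing region. -/
def S₁ (Rcs : ℝ) : Set (ℝ × ℝ × ℝ) := {q | q.1 ≤ Rcs}

/-- The second transmitter is in the protection region of the first receiver. -/
def S₂ (d Rtx : ℝ) : Set (ℝ × ℝ × ℝ) :=
  {q | q.1 ^ 2 - 2 * q.1 * d * Real.cos q.2.1 + d ^ 2 ≤ Rtx ^ 2}

/-- The first transmitter is in the protection region of the second receiver. -/
def S₃ (d Rtx : ℝ) : Set (ℝ × ℝ × ℝ) :=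
  {q | q.1 ^ 2 + 2 * q.1 * d * Real.cos (q.2.1 - q.2.2) + d ^ 2 ≤ Rtx ^ 2}

open Classical in
/-- The function `k(r, φ, 0, θ)`. -/
def k (lamp d Rcs Rtx r φ θ : ℝ) : ℝ :=
  if (r, φ, θ) ∈ S₁ Rcs ∪ S₂ d Rtx ∪ S₃ d Rtx then 0
  else Real.exp (-lamp * unionArea d Rcs Rtx r φ θ)

/-- The closed formula for the mean interference. -/
def interferenceFormula (lamp lam d Rcs Rtx Pt : ℝ) (l : ℝ → ℝ) : ℝ≥0∞ :=
  ENNReal.ofReal (lamp ^ 2 * Pt / (2 * Real.pi * lam)) *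
    ∫⁻ r in Ioi (0 : ℝ), ∫⁻ φ in Icc 0 (2 * Real.pi), ∫⁻ θ in Icc 0 (2 * Real.pi),
      ENNReal.ofReal (l (Real.sqrt (r ^ 2 - 2 * r * d * Real.cos φ + d ^ 2)) *
        k lamp d Rcs Rtx r φ θ * r)

end RtsCts

end

open RtsCts

/-! Everything rests on the Mecke formula: for a Poisson process `Φ` with intensity measure `ν`, the
mean of `∑ F(p, Φ \ p)` over the points `p` is `∫ E F(p, Φ) ν(dp)`. For a point and its
surroundings, this says that an extra point `p` may simply be added to an undisturbed copy of `Φ`.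

Applied to the event that `p` is retained and the other retained pairs are seen in `Y`, it turns the
Campbell measure of the thinned process into a probability about `Φ` with an extra pair. The law of
`Φ` is invariant under rigid motions, so this extra pair can be moved to the origin with orientation
`0`. Its zone is empty with probability `exp (-lamp |zone|)`; hence the intensity is `lamp` times
this number, and conditioning on that event and rotating the surviving points gives a rotation
covariant Palm family (`lintegral_thinned`, `isReducedPalm_palmKernel`).

Under this Palm law the interference is again a sum over points of `Φ`. A second use of the Mecke
formula (`meanInterference_palmKernel_eq_lintegral`) leaves the probability that two given pairs are
both retained: zero if one transmitter lies in the other's zone, and otherwise the void probability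
of the union of the two zones. Polar coordinates finish the computation.

The process is given only by its counts and by iid marks independent of the positions, so the Mecke
formula has to be proved. By Rényi's argument, a finite law on simple configurations is determined
by its void probabilities (`ext_of_voidEvent`). It therefore suffices to test the formula on void
events. There the unmarked case is a computation with Poisson counts, and the marked case follows by
integrating out the marks given the positions. The same uniqueness principle gives invariance under
rigid motions.

An arbitrary Palm family agrees with the constructed one only up to null sets of orientations. Mean
interference depends on a Palm law only through its mean measure, and mean measures are determined
by countably many values, so they agree for almost every orientation (`IsReducedPalm.ae_join_eq`).
For a covariant family the mean interference does not depend on the orientation, so one good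
orientation settles all of them. -/

namespace RtsCts

/-! ### Void probabilities determine simple point processes -/

section Void

variable {E : Type*} [MeasurableSpace E]

/-- A configuration without multiple points. -/
def IsSimple (φ : Measure E) : Prop :=
  ∃ (s : Set ℕ) (p : ℕ → E), InjOn p s ∧ φ = Measure.sum fun j : s => Measure.dirac (p j)

/-- The configurations which charge `C` not at all. -/
def voidEvent (C : Set E) : Set (Measure E) := {φ | φ C = 0}

theorem measurableSet_voidEvent {C : Set E} (hC : MeasurableSet C) :
    MeasurableSet (voidEvent C) :=
  Measure.measurable_coe hC (measurableSet_singleton 0)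

/-- The sigma-algebra generated by the void events of sets of finite `ν`-measure. -/
@[reducible]
def voidSigma (ν : Measure E) : MeasurableSpace (Measure E) :=
  MeasurableSpace.generateFrom {V | ∃ C, MeasurableSet C ∧ ν C < ∞ ∧ V = voidEvent C}

theorem sum_dirac_apply {ι : Type*} (p : ι → E) {A : Set E} (hA : MeasurableSet A) :
    Measure.sum (fun j => Measure.dirac (p j)) A = ∑' j, A.indicator 1 (p j) := by
  rw [Measure.sum_apply _ hA]
  exact tsum_congr fun j => Measure.dirac_apply' _ hA

theorem sum_dirac_eq_zero_iff {ι : Type*} (p : ι → E) {A : Set E} (hA : MeasurableSet A) :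
    Measure.sum (fun j => Measure.dirac (p j)) A = 0 ↔ ∀ j, p j ∉ A := by
  simp [sum_dirac_apply p hA, ENNReal.tsum_eq_zero]

theorem lintegral_sum_dirac {ι : Type*} (p : ι → E) {f : E → ℝ≥0∞} (hf : Measurable f) :
    ∫⁻ x, f x ∂(Measure.sum fun j => Measure.dirac (p j)) = ∑' j, f (p j) := by
  rw [lintegral_sum_measure]
  exact tsum_congr fun j => lintegral_dirac' _ hf

/-- Cells of points whose codes agree in the first `n` bits. -/
def bitCell (f : E → ℕ → Bool) (n : ℕ) (b : Fin n → Bool) : Set E :=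
  {x | (fun i : Fin n => f x i) = b}

theorem measurableSet_bitCell {f : E → ℕ → Bool} (hf : Measurable f) (n : ℕ) (b : Fin n → Bool) :
    MeasurableSet (bitCell f n b) := by
  have : Measurable fun x => (fun i : Fin n => f x i) := by fun_prop
  exact this (measurableSet_singleton b)

/-- For each pair of distinct codes pick one bit where they differ; beyond the largest bit picked,
all points of the finite set are separated. -/
theorem exists_injOn_truncation {α : Type*} {f : α → ℕ → Bool} (F : Finset α) (hf : InjOn f F) :
    ∃ n, InjOn (fun x => fun i : Fin n => f x i) (F : Set α) := by
  classical
  have key : ∀ q : α × α, ∃ k, f q.1 ≠ f q.2 → f q.1 k ≠ f q.2 k := by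
    intro q
    by_cases h : f q.1 = f q.2
    · exact ⟨0, fun h' => absurd h h'⟩
    · obtain ⟨k, hk⟩ := Function.ne_iff.1 h
      exact ⟨k, fun _ => hk⟩
  choose k hk using key
  refine ⟨(F ×ˢ F).sup k + 1, fun x hx y hy hxy => ?_⟩
  by_contra hne
  have hle : k (x, y) ≤ (F ×ˢ F).sup k := Finset.le_sup (Finset.mk_mem_product hx hy)
  exact hk (x, y) (fun h => hne (hf hx hy h)) (congrFun hxy ⟨k (x, y), by omega⟩)

open Classical in
/-- Number of cells of level `n` which meet `A` in a charged set. -/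
noncomputable def cellCount (f : E → ℕ → Bool) (A : Set E) (n : ℕ) (φ : Measure E) : ℝ≥0∞ :=
  ∑ b : Fin n → Bool, if φ (A ∩ bitCell f n b) = 0 then 0 else 1

/-- Rényi's argument. The charged cells never outnumber the points, and any finite family of points
of `A` eventually occupies distinct cells; the latter is where simplicity enters. Counts are thereby
recovered from the knowledge of which sets are void. -/
theorem IsSimple.apply_eq_iSup_cellCount {f : E → ℕ → Bool} (hf : Measurable f)
    (hinj : Function.Injective f) {φ : Measure E} (hφ : IsSimple φ) {A : Set E}
    (hA : MeasurableSet A) : φ A = ⨆ n, cellCount f A n φ := by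
  classical
  obtain ⟨s, p, hp, rfl⟩ := hφ
  have hAc : ∀ n b, MeasurableSet (A ∩ bitCell f n b) := fun n b =>
    hA.inter (measurableSet_bitCell hf n b)
  apply le_antisymm
  · rw [sum_dirac_apply (fun j : s => p j) hA, ENNReal.tsum_eq_iSup_sum]
    refine iSup_le fun F => ?_
    obtain ⟨n, hn⟩ := exists_injOn_truncation (f := fun j : s => f (p j)) F
      (fun x _ y _ h => Subtype.ext (hp x.2 y.2 (hinj h)))
    refine le_iSup_of_le n ?_
    have h1 : ∑ j ∈ F, A.indicator (1 : E → ℝ≥0∞) (p j) =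
        ((F.filter fun j : s => p j ∈ A).card : ℝ≥0∞) := by
      rw [Finset.card_filter]
      push_cast
      exact Finset.sum_congr rfl fun j _ => by simp [indicator_apply]
    have h2 : cellCount f A n (Measure.sum fun j : s => Measure.dirac (p j)) =
        ((Finset.univ.filter fun b : Fin n → Bool =>
          Measure.sum (fun j : s => Measure.dirac (p j)) (A ∩ bitCell f n b) ≠ 0).card : ℝ≥0∞) := by
      rw [Finset.card_filter, cellCount]
      push_cast
      exact Finset.sum_congr rfl fun b _ => by split_ifs <;> simp_all
    rw [h1, h2]
    norm_cast
    refine Finset.card_le_card_of_injOn (fun j : s => fun i : Fin n => f (p j) i) ?_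
      (hn.mono fun j hj => (Finset.mem_filter.1 hj).1)
    intro j hj
    have hj' := (Finset.mem_filter.1 hj).2
    simp only [Finset.coe_filter, Finset.mem_univ, true_and, mem_ofPred_eq]
    rw [sum_dirac_eq_zero_iff (fun j : s => p j) (hAc _ _)]
    push Not
    exact ⟨j, hj', rfl⟩
  · refine iSup_le fun n => ?_
    have hdis : Pairwise (Function.onFun Disjoint fun b : Fin n → Bool => A ∩ bitCell f n b) := by
      intro b c hbc
      refine Set.disjoint_left.2 fun x hx hx' => hbc ?_
      exact hx.2.symm.trans hx'.2
    have hun : A = ⋃ b : Fin n → Bool, A ∩ bitCell f n b := by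
      ext x; simp [bitCell]
    conv_rhs => rw [hun]
    rw [measure_iUnion hdis (hAc n), tsum_fintype]
    refine Finset.sum_le_sum fun b _ => ?_
    split_ifs with h
    · exact zero_le
    · rw [sum_dirac_eq_zero_iff (fun j : s => p j) (hAc _ _)] at h
      push Not at h
      obtain ⟨j, hj⟩ := h
      rw [sum_dirac_apply (fun j : s => p j) (hAc _ _)]
      refine le_trans ?_ (ENNReal.le_tsum j)
      simp [indicator_of_mem hj]

theorem measurable_cellCount {ν : Measure E} {f : E → ℕ → Bool} (hf : Measurable f) {A : Set E}
    (hA : MeasurableSet A) (hνA : ν A < ∞) (n : ℕ) :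
    Measurable[voidSigma ν] (cellCount f A n) := by
  classical
  let : MeasurableSpace (Measure E) := voidSigma ν
  refine Finset.measurable_sum _ fun b _ => Measurable.ite ?_ measurable_const measurable_const
  exact MeasurableSpace.measurableSet_generateFrom ⟨A ∩ bitCell f n b,
    hA.inter (measurableSet_bitCell hf n b), (measure_mono inter_subset_left).trans_lt hνA, rfl⟩

theorem voidSigma_le (ν : Measure E) : voidSigma ν ≤ (inferInstance : MeasurableSpace (Measure E)) := by
  refine MeasurableSpace.generateFrom_le ?_
  rintro V ⟨C, hC, -, rfl⟩
  exact measurableSet_voidEvent hC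

/-- On simple configurations, every event coincides with one of the sigma-algebra generated by
void events. -/
theorem exists_voidSigma_eq_on_simple [MeasurableSpace.CountablySeparated E] (ν : Measure E)
    [SigmaFinite ν] {Y : Set (Measure E)} (hY : MeasurableSet Y) :
    ∃ Y₀, MeasurableSet[voidSigma ν] Y₀ ∧ ∀ φ, IsSimple φ → (φ ∈ Y ↔ φ ∈ Y₀) := by
  obtain ⟨f, hf, hinj⟩ := MeasurableSpace.measurable_injection_nat_bool_of_countablySeparated E
  -- On simple configurations the two sigma-algebras have the same trace: after cutting `A` into
  -- pieces of finite `ν`-measure, its evaluation is a countable sum of suprema of cell counts, each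
  -- a function of void events.
  have key : MeasurableSpace.comap (Subtype.val : {φ : Measure E // IsSimple φ} → Measure E)
      inferInstance ≤ MeasurableSpace.comap Subtype.val (voidSigma ν) := by
    rw [← measurable_iff_comap_le]
    let m0 : MeasurableSpace {φ : Measure E // IsSimple φ} :=
      MeasurableSpace.comap Subtype.val (voidSigma ν)
    refine Measure.measurable_of_measurable_coe _ fun A hA => ?_
    have hS : ∀ φ : {φ : Measure E // IsSimple φ}, φ.1 A =
        ∑' m, ⨆ n, cellCount f (A ∩ disjointed (spanningSets ν) m) n φ.1 := by
      intro φ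
      have hm : ∀ m, MeasurableSet (A ∩ disjointed (spanningSets ν) m) := fun m =>
        hA.inter (MeasurableSet.disjointed (measurableSet_spanningSets ν) m)
      have : A = ⋃ m, A ∩ disjointed (spanningSets ν) m := by
        rw [← inter_iUnion, iUnion_disjointed, iUnion_spanningSets, inter_univ]
      conv_lhs => rw [this]
      rw [measure_iUnion (fun i j hij =>
        (disjoint_disjointed _ hij).mono inter_subset_right inter_subset_right) hm]
      exact tsum_congr fun m => φ.2.apply_eq_iSup_cellCount hf hinj (hm m)
    simp_rw [hS]
    refine Measurable.tsum fun m => Measurable.iSup fun n => ?_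
    have h1 : Measurable[voidSigma ν] (cellCount f (A ∩ disjointed (spanningSets ν) m) n) :=
      measurable_cellCount hf (hA.inter (MeasurableSet.disjointed (measurableSet_spanningSets ν) m))
        ((measure_mono (inter_subset_right.trans (disjointed_subset _ _))).trans_lt
          (measure_spanningSets_lt_top ν m)) n
    exact @Measurable.comp _ _ _ m0 (voidSigma ν) _ _ _ h1 (comap_measurable _)
  obtain ⟨Y₀, hY₀, h⟩ := key _ ⟨Y, hY, rfl⟩
  refine ⟨Y₀, hY₀, fun φ hφ => ?_⟩
  have := congrArg (fun S => (⟨φ, hφ⟩ : {φ : Measure E // IsSimple φ}) ∈ S) h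
  simpa using this.symm

/-- The law `m` gives no mass to the events without simple configurations. -/
def CarriedBySimple (m : Measure (Measure E)) : Prop :=
  ∀ Y, MeasurableSet Y → (∀ φ ∈ Y, ¬ IsSimple φ) → m Y = 0

theorem carriedBySimple_map {Ω : Type*} [MeasurableSpace Ω] {P : Measure Ω} {Z : Ω → Measure E}
    (hZ : Measurable Z) (h : ∀ᵐ ω ∂P, IsSimple (Z ω)) : CarriedBySimple (P.map Z) := by
  intro Y hY hYs
  rw [Measure.map_apply hZ hY]
  exact measure_mono_null (fun ω hω => hYs _ hω) h

theorem carriedBySimple_sum {ι : Type*} {m : ι → Measure (Measure E)}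
    (h : ∀ i, CarriedBySimple (m i)) : CarriedBySimple (Measure.sum m) := by
  intro Y hY hYs
  rw [Measure.sum_apply _ hY]
  simp [h _ Y hY hYs]

theorem CarriedBySimple.smul {m : Measure (Measure E)} (h : CarriedBySimple m) (c : ℝ≥0∞) :
    CarriedBySimple (c • m) := by
  intro Y hY hYs
  simp [h Y hY hYs]

/-- Both differences of the two events are measurable and contain no simple configuration. Arguing
this way avoids any need for the set of simple configurations to be measurable. -/
theorem CarriedBySimple.congr {m : Measure (Measure E)} (h : CarriedBySimple m)
    {Y Y₀ : Set (Measure E)} (hY : MeasurableSet Y) (hY₀ : MeasurableSet Y₀)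
    (hs : ∀ φ, IsSimple φ → (φ ∈ Y ↔ φ ∈ Y₀)) : m Y = m Y₀ := by
  refine measure_congr ?_
  rw [ae_eq_set]
  exact ⟨h _ (hY.diff hY₀) fun φ hφ hsim => hφ.2 ((hs φ hsim).1 hφ.1),
    h _ (hY₀.diff hY) fun φ hφ hsim => hφ.2 ((hs φ hsim).2 hφ.1)⟩

/-- Finite laws on simple configurations with the same void probabilities are equal. -/
theorem ext_of_voidEvent [MeasurableSpace.CountablySeparated E] (ν : Measure E)
    [SigmaFinite ν] {m₁ m₂ : Measure (Measure E)} [IsFiniteMeasure m₁]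
    (h₁ : CarriedBySimple m₁) (h₂ : CarriedBySimple m₂)
    (h : ∀ C, MeasurableSet C → ν C < ∞ → m₁ (voidEvent C) = m₂ (voidEvent C)) : m₁ = m₂ := by
  ext Y hY
  obtain ⟨Y₀, hY₀, hs⟩ := exists_voidSigma_eq_on_simple ν hY
  have hY₀' := voidSigma_le ν _ hY₀
  rw [h₁.congr hY hY₀' hs, h₂.congr hY hY₀' hs]
  have huniv : m₁ univ = m₂ univ := by
    have := h ∅ MeasurableSet.empty (by simp)
    simpa [voidEvent] using this
  -- Void events form a π-system, since avoiding `C` and `C'` means avoiding `C ∪ C'`.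
  have e : m₁.trim (voidSigma_le ν) = m₂.trim (voidSigma_le ν) := by
    have : IsFiniteMeasure (m₁.trim (voidSigma_le ν)) := isFiniteMeasure_trim _
    refine @ext_of_generate_finite _ (voidSigma ν) _ _ _ rfl ?_ _ ?_ ?_
    · rintro _ ⟨C, hC, hνC, rfl⟩ _ ⟨C', hC', hνC', rfl⟩ -
      refine ⟨C ∪ C', hC.union hC', measure_union_lt_top hνC hνC', ?_⟩
      ext φ
      simp [voidEvent, measure_union_null_iff]
    · rintro _ ⟨C, hC, hνC, rfl⟩
      have hm : MeasurableSet[voidSigma ν] (voidEvent C) :=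
        MeasurableSpace.measurableSet_generateFrom ⟨C, hC, hνC, rfl⟩
      rw [trim_measurableSet_eq _ hm, trim_measurableSet_eq _ hm, h C hC hνC]
    · rw [trim_measurableSet_eq _ MeasurableSet.univ, trim_measurableSet_eq _ MeasurableSet.univ,
        huniv]
  rw [← trim_measurableSet_eq (voidSigma_le ν) hY₀, e, trim_measurableSet_eq _ hY₀]

end Void

/-! ### The Mecke formula from void probabilities -/

section Mecke

variable {E : Type*} [MeasurableSpace E] {Ω : Type*} [MeasurableSpace Ω]

/-- The counting measure of a sequence of points. -/
noncomputable def allPoints (p : ℕ → E) : Measure E := Measure.sum fun j => Measure.dirac (p j)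

/-- The counting measure of a sequence of points without its point of index `i`. -/
noncomputable def otherPoints (p : ℕ → E) (i : ℕ) : Measure E :=
  Measure.sum fun j : ({i}ᶜ : Set ℕ) => Measure.dirac (p j)

theorem measurable_sum_dirac {ι : Type*} [Countable ι] {p : ι → Ω → E}
    (hp : ∀ i, Measurable (p i)) :
    Measurable fun ω => Measure.sum fun j => Measure.dirac (p j ω) := by
  refine Measure.measurable_of_measurable_coe _ fun A hA => ?_
  simp_rw [sum_dirac_apply _ hA]
  exact Measurable.tsum fun j => (measurable_one.indicator hA).comp (hp j)

theorem measurable_allPoints {p : ℕ → Ω → E} (hp : ∀ i, Measurable (p i)) :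
    Measurable fun ω => allPoints fun j => p j ω :=
  measurable_sum_dirac hp

theorem measurable_otherPoints {p : ℕ → Ω → E} (hp : ∀ i, Measurable (p i)) (i : ℕ) :
    Measurable fun ω => otherPoints (fun j => p j ω) i :=
  measurable_sum_dirac fun j : ({i}ᶜ : Set ℕ) => hp j

theorem isSimple_otherPoints {p : ℕ → E} (hp : Function.Injective p) (i : ℕ) :
    IsSimple (otherPoints p i) :=
  ⟨{i}ᶜ, p, hp.injOn, rfl⟩

theorem isSimple_allPoints {p : ℕ → E} (hp : Function.Injective p) : IsSimple (allPoints p) := by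
  refine ⟨univ, p, hp.injOn, ?_⟩
  ext A hA
  rw [allPoints, sum_dirac_apply _ hA, sum_dirac_apply (fun j : (univ : Set ℕ) => p j) hA]
  exact (tsum_univ fun j => A.indicator (1 : E → ℝ≥0∞) (p j)).symm

theorem otherPoints_eq_zero_iff (p : ℕ → E) (i : ℕ) {C : Set E} (hC : MeasurableSet C) :
    otherPoints p i C = 0 ↔ ∀ j, j ≠ i → p j ∉ C := by
  rw [otherPoints, sum_dirac_eq_zero_iff (fun j : ({i}ᶜ : Set ℕ) => p j) hC]
  simp

theorem allPoints_eq_zero_iff (p : ℕ → E) {C : Set E} (hC : MeasurableSet C) :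
    allPoints p C = 0 ↔ ∀ j, p j ∉ C :=
  sum_dirac_eq_zero_iff p hC

theorem lintegral_allPoints (p : ℕ → E) {f : E → ℝ≥0∞} (hf : Measurable f) :
    ∫⁻ x, f x ∂(allPoints p) = ∑' j, f (p j) :=
  lintegral_sum_dirac p hf

variable {P : Measure Ω} {ν : Measure E} {p : ℕ → Ω → E}

/-- The joint law of the points and the remaining configurations, for a process whose reduced
Campbell measure is a product on void events. -/
theorem campbell_eq_prod [MeasurableSpace.CountablySeparated E] [IsProbabilityMeasure P]
    [SigmaFinite ν] (hp : ∀ i, Measurable (p i))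
    (hinj : ∀ᵐ ω ∂P, Function.Injective fun i => p i ω)
    (hvoid : ∀ D C, MeasurableSet D → MeasurableSet C → ν D < ∞ → ν C < ∞ →
      ∑' i, P {ω | p i ω ∈ D ∧ ∀ j, j ≠ i → p j ω ∉ C} = ν D * P {ω | ∀ j, p j ω ∉ C}) :
    Measure.sum (fun i => P.map fun ω => (p i ω, otherPoints (fun j => p j ω) i)) =
      ν.prod (P.map fun ω => allPoints fun j => p j ω) := by
  have hall := measurable_allPoints hp
  have hoth := measurable_otherPoints hp
  have hfin : ∀ D, MeasurableSet D → ν D < ∞ →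
      Measure.sum (fun i => (P.restrict (p i ⁻¹' D)).map fun ω => otherPoints (fun j => p j ω) i) =
        ν D • P.map fun ω => allPoints fun j => p j ω := by
    intro D hD hνD
    -- `ext_of_voidEvent` asks only its first law to be finite. The multiple of a probability law is
    -- visibly so; the sum over `i` is not.
    symm
    have : IsProbabilityMeasure (P.map fun ω => allPoints fun j => p j ω) :=
      Measure.isProbabilityMeasure_map hall.aemeasurable
    have : IsFiniteMeasure (ν D • P.map fun ω => allPoints fun j => p j ω) :=
      Measure.smul_finite _ hνD.ne
    refine ext_of_voidEvent ν ?_ ?_ ?_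
    · exact (carriedBySimple_map hall (hinj.mono fun ω hω => isSimple_allPoints hω)).smul _
    · exact carriedBySimple_sum fun i => carriedBySimple_map (hoth i)
        (ae_restrict_of_ae (hinj.mono fun ω hω => isSimple_otherPoints hω i))
    · intro C hC hνC
      rw [Measure.smul_apply, Measure.map_apply hall (measurableSet_voidEvent hC),
        Measure.sum_apply _ (measurableSet_voidEvent hC), smul_eq_mul]
      have h1 : (fun ω => allPoints fun j => p j ω) ⁻¹' voidEvent C = {ω | ∀ j, p j ω ∉ C} := by
        ext ω
        exact allPoints_eq_zero_iff (fun j => p j ω) hC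
      rw [h1, ← hvoid D C hD hC hνD hνC]
      refine tsum_congr fun i => ?_
      rw [Measure.map_apply (hoth i) (measurableSet_voidEvent hC),
        Measure.restrict_apply (hoth i (measurableSet_voidEvent hC))]
      congr 1
      ext ω
      simp only [voidEvent, preimage_ofPred_eq, mem_inter_iff, mem_ofPred_eq, mem_preimage,
        otherPoints_eq_zero_iff _ _ hC]
      exact and_comm
  have : IsProbabilityMeasure (P.map fun ω => allPoints fun j => p j ω) :=
    Measure.isProbabilityMeasure_map hall.aemeasurable
  symm
  have hrect : ∀ D Y, MeasurableSet D → MeasurableSet Y → ν D < ∞ →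
      Measure.sum (fun i => P.map fun ω => (p i ω, otherPoints (fun j => p j ω) i)) (D ×ˢ Y) =
        ν D * (P.map fun ω => allPoints fun j => p j ω) Y := by
    intro D Y hD hY hνD
    have := congrArg (fun m => m Y) (hfin D hD hνD)
    simp only [Measure.smul_apply, smul_eq_mul] at this
    rw [← this, Measure.sum_apply _ hY, Measure.sum_apply _ (hD.prod hY)]
    refine tsum_congr fun i => ?_
    rw [Measure.map_apply ((hp i).prodMk (hoth i)) (hD.prod hY), Measure.map_apply (hoth i) hY,
      Measure.restrict_apply (hoth i hY)]
    congr 1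
    ext ω
    simp [and_comm]
  refine Measure.prod_eq_generateFrom (C := {D | MeasurableSet D ∧ ν D < ∞})
    (D := {Y | MeasurableSet Y}) ?_ MeasurableSpace.generateFrom_measurableSet ?_
    MeasurableSpace.isPiSystem_measurableSet ?_ ?_ ?_
  · refine le_antisymm (MeasurableSpace.generateFrom_le fun D hD => hD.1) fun D hD => ?_
    have : D = ⋃ n, D ∩ spanningSets ν n := by
      rw [← inter_iUnion, iUnion_spanningSets, inter_univ]
    rw [this]
    exact MeasurableSet.iUnion fun n => MeasurableSpace.measurableSet_generateFrom
      ⟨hD.inter (measurableSet_spanningSets ν n),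
        (measure_mono inter_subset_right).trans_lt (measure_spanningSets_lt_top ν n)⟩
  · rintro D ⟨hD, hνD⟩ D' ⟨hD', -⟩ -
    exact ⟨hD.inter hD', (measure_mono inter_subset_left).trans_lt hνD⟩
  · exact ⟨spanningSets ν, fun n => ⟨measurableSet_spanningSets ν n,
      measure_spanningSets_lt_top ν n⟩, fun n => measure_spanningSets_lt_top ν n,
      iUnion_spanningSets ν⟩
  · exact ⟨fun _ => univ, fun _ => by simp, fun _ => measure_lt_top _ _,
      iUnion_const _⟩
  · rintro D ⟨hD, hνD⟩ Y hY
    exact hrect D Y hD hY hνD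

/-- `p` enumerates a process satisfying the Mecke formula with intensity measure `ν`. -/
def SatisfiesMecke (P : Measure Ω) (ν : Measure E) (p : ℕ → Ω → E) : Prop :=
  ∀ F : E × Measure E → ℝ≥0∞, Measurable F →
    ∑' i, ∫⁻ ω, F (p i ω, otherPoints (fun j => p j ω) i) ∂P =
      ∫⁻ x, ∫⁻ ω, F (x, allPoints fun j => p j ω) ∂P ∂ν

theorem satisfiesMecke_of_void [MeasurableSpace.CountablySeparated E] [IsProbabilityMeasure P]
    [SigmaFinite ν] (hp : ∀ i, Measurable (p i))
    (hinj : ∀ᵐ ω ∂P, Function.Injective fun i => p i ω)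
    (hvoid : ∀ D C, MeasurableSet D → MeasurableSet C → ν D < ∞ → ν C < ∞ →
      ∑' i, P {ω | p i ω ∈ D ∧ ∀ j, j ≠ i → p j ω ∉ C} = ν D * P {ω | ∀ j, p j ω ∉ C}) :
    SatisfiesMecke P ν p := by
  intro F hF
  have hall := measurable_allPoints hp
  have hoth := measurable_otherPoints hp
  have h := congrArg (fun m => ∫⁻ z, F z ∂m) (campbell_eq_prod hp hinj hvoid)
  have : IsProbabilityMeasure (P.map fun ω => allPoints fun j => p j ω) :=
    Measure.isProbabilityMeasure_map hall.aemeasurable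
  simp only [lintegral_sum_measure] at h
  rw [lintegral_prod _ hF.aemeasurable] at h
  convert h using 1
  · exact tsum_congr fun i => (lintegral_map hF ((hp i).prodMk (hoth i))).symm
  · exact lintegral_congr fun x => (lintegral_map (hF.comp measurable_prodMk_left) hall).symm

end Mecke

/-! ### The unmarked Poisson process -/

theorem lintegral_natCast_poissonMeasure (r : ℝ≥0) :
    ∫⁻ n, (n : ℝ≥0∞) ∂(poissonMeasure r) = r := by
  rw [lintegral_countable', tsum_eq_zero_add' ENNReal.summable]
  simp only [Nat.cast_zero, zero_mul, zero_add]
  have h : ∀ n : ℕ, ((n + 1 : ℕ) : ℝ≥0∞) * poissonMeasure r {n + 1} =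
      r * poissonMeasure r {n} := by
    intro n
    rw [poissonMeasure_singleton, poissonMeasure_singleton, ← ENNReal.ofReal_natCast,
      ← ENNReal.ofReal_coe_nnreal, ← ENNReal.ofReal_mul (by positivity),
      ← ENNReal.ofReal_mul (by positivity)]
    congr 1
    rw [Nat.factorial_succ]
    have : (n.factorial : ℝ) ≠ 0 := by positivity
    push_cast
    field_simp
    ring
  simp_rw [h]
  rw [ENNReal.tsum_mul_left]
  have := lintegral_countable' (μ := poissonMeasure r) fun _ => (1 : ℝ≥0∞)
  simp only [one_mul, lintegral_const, measure_univ, mul_one] at this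
  rw [← this, mul_one]

section Unmarked

variable {Ω : Type*} [MeasurableSpace Ω] {P : Measure Ω} {lamp : ℝ} {X : ℕ → Ω → Plane}

theorem poisson_lintegral_count (hX : IsPoissonProcess P lamp X) {B : Set Plane}
    (hB : MeasurableSet B) (hfin : volume B < ∞) :
    ∫⁻ ω, allPoints (fun i => X i ω) B ∂P = ENNReal.ofReal lamp * volume B := by
  have h := (hX.hasLaw_count B hB hfin).lintegral_comp (f := fun x => x) aemeasurable_id
  have hN : (fun ω => allPoints (fun i => X i ω) B) =
    fun ω => Measure.sum (fun i => Measure.dirac (X i ω)) B := rfl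
  rw [hN, h, lintegral_map (f := fun x : ℝ≥0∞ => x) measurable_id (by fun_prop)]
  rw [lintegral_natCast_poissonMeasure]
  exact ENNReal.coe_toNNReal (ENNReal.mul_lt_top ENNReal.ofReal_lt_top hfin).ne

theorem poisson_measure_count_eq (hX : IsPoissonProcess P lamp X) {B : Set Plane}
    (hB : MeasurableSet B) (hfin : volume B < ∞) (n : ℕ) :
    P {ω | allPoints (fun i => X i ω) B = n} =
      poissonMeasure (ENNReal.ofReal lamp * volume B).toNNReal {n} := by
  have h := hX.hasLaw_count B hB hfin
  have h2 : P {ω | allPoints (fun i => X i ω) B = n} =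
      (P.map fun ω => Measure.sum (fun i => Measure.dirac (X i ω)) B) {(n : ℝ≥0∞)} := by
    rw [Measure.map_apply_of_aemeasurable h.aemeasurable (measurableSet_singleton _)]
    rfl
  rw [h2, h.map_eq, Measure.map_apply (by fun_prop) (measurableSet_singleton _)]
  congr 1
  ext m
  simp

/-- Void probabilities of the Poisson process. -/
theorem poisson_void (hX : IsPoissonProcess P lamp X) {B : Set Plane}
    (hB : MeasurableSet B) (hfin : volume B < ∞) :
    P {ω | allPoints (fun i => X i ω) B = 0} =
      ENNReal.ofReal (Real.exp (-(ENNReal.ofReal lamp * volume B).toReal)) := by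
  have := poisson_measure_count_eq hX hB hfin 0
  simp only [Nat.cast_zero] at this
  rw [this, poissonMeasure_singleton]
  simp [ENNReal.coe_toNNReal_eq_toReal]

theorem poisson_one (hX : IsPoissonProcess P lamp X) {B : Set Plane}
    (hB : MeasurableSet B) (hfin : volume B < ∞) :
    P {ω | allPoints (fun i => X i ω) B = 1} =
      ENNReal.ofReal lamp * volume B *
        ENNReal.ofReal (Real.exp (-(ENNReal.ofReal lamp * volume B).toReal)) := by
  have := poisson_measure_count_eq hX hB hfin 1
  simp only [Nat.cast_one] at this
  rw [this, poissonMeasure_singleton]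
  have hne := (ENNReal.mul_lt_top (ENNReal.ofReal_lt_top (r := lamp)) hfin).ne
  conv_rhs => rw [← ENNReal.ofReal_toReal hne]
  rw [← ENNReal.ofReal_mul ENNReal.toReal_nonneg]
  congr 1
  simp [mul_comm, ENNReal.coe_toNNReal_eq_toReal]

theorem measurable_count (hX : IsPoissonProcess P lamp X) {B : Set Plane}
    (hB : MeasurableSet B) : Measurable fun ω => allPoints (fun i => X i ω) B :=
  (Measure.measurable_coe hB).comp (measurable_allPoints hX.measurable)

theorem poisson_indepFun (hX : IsPoissonProcess P lamp X) {A B : Set Plane}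
    (hA : MeasurableSet A) (hB : MeasurableSet B) (hAfin : volume A < ∞) (hBfin : volume B < ∞)
    (hAB : Disjoint A B) :
    IndepFun (fun ω => allPoints (fun i => X i ω) A) (fun ω => allPoints (fun i => X i ω) B) P := by
  have h := hX.indep_count 2 ![A, B] (by simp [Fin.forall_fin_two, hA, hB])
    (by simp [Fin.forall_fin_two, hAfin, hBfin])
    (by
      intro i j hij
      fin_cases i <;> fin_cases j <;> simp_all [disjoint_comm])
  exact h.indepFun (i := 0) (j := 1) (by decide)

/-- With mean `m`, the probability is `1 - (1 + m) exp (-m)`, and `exp (-m) ≥ 1 - m` bounds it by `1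
- (1 + m)(1 - m) = m ^ 2`. -/
theorem poisson_measure_two_le [IsProbabilityMeasure P] (hX : IsPoissonProcess P lamp X)
    {B : Set Plane} (hB : MeasurableSet B) (hfin : volume B < ∞) :
    P {ω | allPoints (fun i => X i ω) B ≠ 0 ∧ allPoints (fun i => X i ω) B ≠ 1} ≤
      (ENNReal.ofReal lamp * volume B) ^ 2 := by
  set m := (ENNReal.ofReal lamp * volume B).toReal with hm
  have hne := (ENNReal.mul_lt_top (ENNReal.ofReal_lt_top (r := lamp)) hfin).ne
  have hmm : ENNReal.ofReal lamp * volume B = ENNReal.ofReal m := (ENNReal.ofReal_toReal hne).symm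
  have hm0 : 0 ≤ m := ENNReal.toReal_nonneg
  have hmeas := measurable_count hX hB
  have h0 : MeasurableSet {ω | allPoints (fun i => X i ω) B = 0} := hmeas (measurableSet_singleton 0)
  have h1 : MeasurableSet {ω | allPoints (fun i => X i ω) B = 1} := hmeas (measurableSet_singleton 1)
  have hset : {ω | allPoints (fun i => X i ω) B ≠ 0 ∧ allPoints (fun i => X i ω) B ≠ 1} =
      ({ω | allPoints (fun i => X i ω) B = 0} ∪ {ω | allPoints (fun i => X i ω) B = 1})ᶜ := by
    ext ω; simp
  have hdisj : Disjoint {ω | allPoints (fun i => X i ω) B = 0}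
      {ω | allPoints (fun i => X i ω) B = 1} := by
    refine Set.disjoint_left.2 fun ω h h' => ?_
    rw [mem_ofPred_eq] at h h'
    rw [h] at h'
    exact zero_ne_one h'
  rw [hset, prob_compl_eq_one_sub (h0.union h1), measure_union hdisj h1, poisson_void hX hB hfin,
    poisson_one hX hB hfin, ← hm, hmm, ← ENNReal.ofReal_mul hm0,
    ← ENNReal.ofReal_add (by positivity) (by positivity), ← ENNReal.ofReal_one,
    ← ENNReal.ofReal_sub _ (by positivity), ← ENNReal.ofReal_pow hm0]
  refine ENNReal.ofReal_le_ofReal ?_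
  have := Real.add_one_le_exp (-m)
  nlinarith

/-- Coinciding points put at least two points in one cell of every partition. For cells of area at
most `π δ ^ 2`, the quadratic bound of `poisson_measure_two_le` sums to a quantity of order `δ ^ 2`
on a bounded region, and `δ` tends to `0`. -/
theorem poisson_ae_injective [IsProbabilityMeasure P] (hX : IsPoissonProcess P lamp X) :
    ∀ᵐ ω ∂P, Function.Injective fun i => X i ω := by
  set bad : Set Plane → Set Ω := fun A => {ω | ∃ i j, i ≠ j ∧ X i ω = X j ω ∧ X i ω ∈ A} with hbad
  have hle : ∀ A, MeasurableSet A → volume A < ∞ →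
      P (bad A) ≤ (ENNReal.ofReal lamp * volume A) ^ 2 := by
    intro A hA hfin
    refine (measure_mono ?_).trans (poisson_measure_two_le hX hA hfin)
    rintro ω ⟨i, j, hij, hXij, hiA⟩
    have h2 : (2 : ℝ≥0∞) ≤ allPoints (fun i => X i ω) A := by
      rw [allPoints, sum_dirac_apply _ hA]
      refine le_trans ?_ (ENNReal.sum_le_tsum {i, j})
      rw [Finset.sum_pair hij]
      rw [indicator_of_mem hiA, indicator_of_mem (hXij ▸ hiA)]
      norm_num
    constructor
    · intro h; rw [h] at h2; simp at h2
    · intro h; rw [h] at h2; norm_num at h2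
  have hnull : ∀ n : ℕ, P (bad (Metric.ball 0 n)) = 0 := by
    intro n
    set A : Set Plane := Metric.ball 0 n
    have hA : MeasurableSet A := measurableSet_ball
    have hAfin : volume A < ∞ := measure_ball_lt_top
    set K : ℝ≥0∞ := ENNReal.ofReal lamp * ENNReal.ofReal Real.pi * (ENNReal.ofReal lamp * volume A) with hK
    have hKfin : K ≠ ∞ := by
      refine ENNReal.mul_ne_top (ENNReal.mul_ne_top ENNReal.ofReal_ne_top ENNReal.ofReal_ne_top) ?_
      exact ENNReal.mul_ne_top ENNReal.ofReal_ne_top hAfin.ne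
    have hb : ∀ δ : ℝ, 0 < δ → P (bad A) ≤ ENNReal.ofReal δ ^ 2 * K := by
      intro δ hδ
      set x := TopologicalSpace.denseSeq Plane
      set U := disjointed fun k => Metric.ball (x k) δ
      have hUm : ∀ k, MeasurableSet (U k) := fun k =>
        MeasurableSet.disjointed (fun _ => measurableSet_ball) k
      have hU : ⋃ k, U k = univ := by
        rw [iUnion_disjointed, eq_univ_iff_forall]
        intro y
        obtain ⟨k, hk⟩ := (TopologicalSpace.denseRange_denseSeq Plane).exists_dist_lt y hδ
        exact mem_iUnion.2 ⟨k, hk⟩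
      have hvol : ∀ k, volume (A ∩ U k) ≤ ENNReal.ofReal δ ^ 2 * ENNReal.ofReal Real.pi := by
        intro k
        rw [← EuclideanSpace.volume_ball_fin_two]
        exact measure_mono (inter_subset_right.trans (disjointed_subset _ k))
      calc P (bad A) ≤ P (⋃ k, bad (A ∩ U k)) := by
            refine measure_mono ?_
            rintro ω ⟨i, j, hij, hXij, hiA⟩
            obtain ⟨k, hk⟩ := mem_iUnion.1 (hU ▸ mem_univ (X i ω))
            exact mem_iUnion.2 ⟨k, i, j, hij, hXij, hiA, hk⟩
        _ ≤ ∑' k, P (bad (A ∩ U k)) := measure_iUnion_le _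
        _ ≤ ∑' k, (ENNReal.ofReal lamp * (ENNReal.ofReal δ ^ 2 * ENNReal.ofReal Real.pi)) *
              (ENNReal.ofReal lamp * volume (A ∩ U k)) := by
            refine ENNReal.tsum_le_tsum fun k => ?_
            refine (hle _ (hA.inter (hUm k))
              ((measure_mono inter_subset_left).trans_lt hAfin)).trans ?_
            rw [sq]
            gcongr
            exact hvol k
        _ = ENNReal.ofReal δ ^ 2 * K := by
            rw [ENNReal.tsum_mul_left, ENNReal.tsum_mul_left, ← measure_iUnion
              (fun i j hij => (disjoint_disjointed _ hij).mono inter_subset_right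
                inter_subset_right) (fun k => hA.inter (hUm k)), ← inter_iUnion, hU, inter_univ, hK]
            ring
    have ht : Filter.Tendsto (fun δ : ℝ => ENNReal.ofReal δ ^ 2 * K) (nhdsWithin 0 (Ioi 0))
        (nhds 0) := by
      have h1 : Filter.Tendsto (fun δ : ℝ => ENNReal.ofReal δ ^ 2) (nhdsWithin 0 (Ioi 0))
          (nhds 0) := by
        have : Continuous fun δ : ℝ => ENNReal.ofReal δ ^ 2 :=
          (ENNReal.continuous_pow 2).comp ENNReal.continuous_ofReal
        have h := (this.tendsto 0).mono_left (nhdsWithin_le_nhds (s := Ioi 0))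
        simpa using h
      simpa using ENNReal.Tendsto.mul_const h1 (Or.inr hKfin)
    refine le_antisymm (ge_of_tendsto ht ?_) zero_le
    filter_upwards [self_mem_nhdsWithin] with δ hδ using hb δ hδ
  have hall : ∀ᵐ ω ∂P, ∀ n : ℕ, ω ∉ bad (Metric.ball 0 n) :=
    ae_all_iff.2 fun n => measure_eq_zero_iff_ae_notMem.1 (hnull n)
  filter_upwards [hall] with ω hω i j hij
  by_contra hne
  obtain ⟨n, hn⟩ := exists_nat_gt ‖X i ω‖
  exact hω n ⟨i, j, hne, hij, by simpa using hn⟩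

/-- If `C` is empty, every point of `D` contributes, and all of these lie in `D \ C`. If `C` is
occupied, only a sole point of `C` can contribute, and it must lie in `D`. Each term is a product of
functions of counts in disjoint sets, ready for independence. -/
theorem tsum_indicator_other_void (x : ℕ → Plane) {D C : Set Plane} (hD : MeasurableSet D)
    (hC : MeasurableSet C) :
    ∑' i, {i | x i ∈ D ∧ ∀ j, j ≠ i → x j ∉ C}.indicator (1 : ℕ → ℝ≥0∞) i =
      allPoints x (D \ C) * ({0} : Set ℝ≥0∞).indicator 1 (allPoints x C) +
        ({1} : Set ℝ≥0∞).indicator 1 (allPoints x (D ∩ C)) *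
          ({0} : Set ℝ≥0∞).indicator 1 (allPoints x (C \ D)) := by
  classical
  by_cases h : ∀ j, x j ∉ C
  · have h0 : allPoints x C = 0 := (allPoints_eq_zero_iff x hC).2 h
    have h1 : allPoints x (D ∩ C) = 0 := measure_mono_null inter_subset_right h0
    rw [h0, h1, allPoints, sum_dirac_apply _ (hD.diff hC)]
    simp only [mem_singleton_iff, indicator_of_mem, Pi.one_apply, mul_one, zero_ne_one,
      not_false_eq_true, indicator_of_notMem, zero_mul, add_zero]
    refine tsum_congr fun i => ?_
    simp only [indicator_apply, mem_ofPred_eq, mem_sdiff]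
    have : (x i ∈ D ∧ ∀ j, j ≠ i → x j ∉ C) ↔ (x i ∈ D ∧ x i ∉ C) := by
      constructor
      · exact fun h' => ⟨h'.1, h i⟩
      · exact fun h' => ⟨h'.1, fun j _ => h j⟩
    simp [this]
  · push Not at h
    obtain ⟨j₀, hj₀⟩ := h
    have h0 : allPoints x C ≠ 0 := fun h => (allPoints_eq_zero_iff x hC).1 h j₀ hj₀
    rw [indicator_of_notMem (show allPoints x C ∉ ({0} : Set ℝ≥0∞) from h0), mul_zero, zero_add]
    rw [tsum_eq_single j₀ (fun i hi => indicator_of_notMem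
      (fun h' => h'.2 j₀ (Ne.symm hi) hj₀) _)]
    have hiff : (x j₀ ∈ D ∧ ∀ j, j ≠ j₀ → x j ∉ C) ↔
        (allPoints x (D ∩ C) = 1 ∧ allPoints x (C \ D) = 0) := by
      constructor
      · rintro ⟨hD', hj⟩
        constructor
        · rw [allPoints, sum_dirac_apply _ (hD.inter hC), tsum_eq_single j₀]
          · rw [indicator_of_mem (show x j₀ ∈ D ∩ C from ⟨hD', hj₀⟩)]; rfl
          · exact fun j hne => indicator_of_notMem (fun h' => hj j hne h'.2) _
        · refine (allPoints_eq_zero_iff x (hC.diff hD)).2 fun j h' => ?_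
          by_cases hjj : j = j₀
          · exact h'.2 (hjj ▸ hD')
          · exact hj j hjj h'.1
      · rintro ⟨h1, h2⟩
        rw [allPoints_eq_zero_iff x (hC.diff hD)] at h2
        have hin : ∀ j, x j ∈ C → x j ∈ D := fun j hj => by
          by_contra hjD
          exact h2 j ⟨hj, hjD⟩
        refine ⟨hin j₀ hj₀, fun j hne hj => ?_⟩
        have h3 : (2 : ℝ≥0∞) ≤ allPoints x (D ∩ C) := by
          rw [allPoints, sum_dirac_apply _ (hD.inter hC)]
          refine le_trans ?_ (ENNReal.sum_le_tsum {j, j₀})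
          rw [Finset.sum_pair hne, indicator_of_mem (show x j ∈ D ∩ C from ⟨hin j hj, hj⟩),
            indicator_of_mem (show x j₀ ∈ D ∩ C from ⟨hin j₀ hj₀, hj₀⟩)]
          norm_num
        rw [h1] at h3
        norm_num at h3
    simp only [indicator_apply, mem_ofPred_eq, hiff, mem_singleton_iff, Pi.one_apply]
    split_ifs <;> simp_all

/-- Taking means in `tsum_indicator_other_void` gives `lamp |D \ C|` and `lamp |D ∩ C|`, each times
`exp (-lamp |C|)`; in the second term the exponential comes from `D ∩ C` and `C \ D` together. -/
theorem poisson_campbell_void [IsProbabilityMeasure P] (hX : IsPoissonProcess P lamp X)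
    {D C : Set Plane} (hD : MeasurableSet D) (hC : MeasurableSet C) (hDfin : volume D < ∞)
    (hCfin : volume C < ∞) :
    ∑' i, P {ω | X i ω ∈ D ∧ ∀ j, j ≠ i → X j ω ∉ C} =
      ENNReal.ofReal lamp * volume D * P {ω | ∀ j, X j ω ∉ C} := by
  have hm : ∀ i, MeasurableSet {ω | X i ω ∈ D ∧ ∀ j, j ≠ i → X j ω ∉ C} := by
    intro i
    refine (hX.measurable i hD).inter ?_
    have : {ω | ∀ j, j ≠ i → X j ω ∉ C} = ⋂ j, ⋂ (_ : j ≠ i), X j ⁻¹' Cᶜ := by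
      ext ω; simp
    have h : MeasurableSet {ω | ∀ j, j ≠ i → X j ω ∉ C} := by
      rw [this]
      exact MeasurableSet.iInter fun j => MeasurableSet.iInter fun _ =>
        hX.measurable j hC.compl
    exact h
  have hvC : P {ω | ∀ j, X j ω ∉ C} = P {ω | allPoints (fun i => X i ω) C = 0} := by
    congr 1
    ext ω
    exact (allPoints_eq_zero_iff _ hC).symm
  have hDC : volume (D \ C) < ∞ := (measure_mono sdiff_subset).trans_lt hDfin
  have hCD : volume (C \ D) < ∞ := (measure_mono sdiff_subset).trans_lt hCfin
  have hI : volume (D ∩ C) < ∞ := (measure_mono inter_subset_left).trans_lt hDfin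
  have hmeas0 : Measurable (({0} : Set ℝ≥0∞).indicator (1 : ℝ≥0∞ → ℝ≥0∞)) :=
    measurable_one.indicator (measurableSet_singleton 0)
  have hmeas1 : Measurable (({1} : Set ℝ≥0∞).indicator (1 : ℝ≥0∞ → ℝ≥0∞)) :=
    measurable_one.indicator (measurableSet_singleton 1)
  have hpt : ∀ (a : ℝ≥0∞) {B : Set Plane}, MeasurableSet B →
      ∫⁻ ω, ({a} : Set ℝ≥0∞).indicator (1 : ℝ≥0∞ → ℝ≥0∞) (allPoints (fun i => X i ω) B) ∂P =
        P {ω | allPoints (fun i => X i ω) B = a} := by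
    intro a B hB
    exact lintegral_indicator_one (measurable_count hX hB (measurableSet_singleton a))
  calc ∑' i, P {ω | X i ω ∈ D ∧ ∀ j, j ≠ i → X j ω ∉ C}
      = ∑' i, ∫⁻ ω, {i | X i ω ∈ D ∧ ∀ j, j ≠ i → X j ω ∉ C}.indicator (1 : ℕ → ℝ≥0∞) i ∂P := by
        refine tsum_congr fun i => ?_
        rw [← lintegral_indicator_one (hm i)]
        rfl
    _ = ∫⁻ ω, ∑' i, {i | X i ω ∈ D ∧ ∀ j, j ≠ i → X j ω ∉ C}.indicator (1 : ℕ → ℝ≥0∞) i ∂P :=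
        (lintegral_tsum fun i => (measurable_one.indicator (hm i)).aemeasurable).symm
    _ = ∫⁻ ω, (allPoints (fun i => X i ω) (D \ C) *
          ({0} : Set ℝ≥0∞).indicator 1 (allPoints (fun i => X i ω) C) +
        ({1} : Set ℝ≥0∞).indicator 1 (allPoints (fun i => X i ω) (D ∩ C)) *
          ({0} : Set ℝ≥0∞).indicator 1 (allPoints (fun i => X i ω) (C \ D))) ∂P :=
        lintegral_congr fun ω => tsum_indicator_other_void _ hD hC
    _ = ENNReal.ofReal lamp * volume (D \ C) * P {ω | allPoints (fun i => X i ω) C = 0} +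
        P {ω | allPoints (fun i => X i ω) (D ∩ C) = 1} *
          P {ω | allPoints (fun i => X i ω) (C \ D) = 0} := by
        have hi1 := (poisson_indepFun hX (hD.diff hC) hC hDC hCfin disjoint_sdiff_left).comp
          measurable_id hmeas0
        have hi2 := (poisson_indepFun hX (hD.inter hC) (hC.diff hD) hI hCD
          (Set.disjoint_left.2 fun x hx hx' => hx'.2 hx.1)).comp hmeas1 hmeas0
        refine (lintegral_add_left ((measurable_count hX (hD.diff hC)).mul
          (hmeas0.comp (measurable_count hX hC))) _).trans ?_
        congr 1
        · rw [← poisson_lintegral_count hX (hD.diff hC) hDC, ← hpt 0 hC]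
          exact lintegral_mul_eq_lintegral_mul_lintegral_of_indepFun''
            (measurable_count hX (hD.diff hC)).aemeasurable
            (hmeas0.comp (measurable_count hX hC)).aemeasurable hi1
        · rw [← hpt 1 (hD.inter hC), ← hpt 0 (hC.diff hD)]
          exact lintegral_mul_eq_lintegral_mul_lintegral_of_indepFun''
            (hmeas1.comp (measurable_count hX (hD.inter hC))).aemeasurable
            (hmeas0.comp (measurable_count hX (hC.diff hD))).aemeasurable hi2
    _ = ENNReal.ofReal lamp * volume D * P {ω | ∀ j, X j ω ∉ C} := by
        rw [hvC, poisson_one hX (hD.inter hC) hI, poisson_void hX (hC.diff hD) hCD,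
          poisson_void hX hC hCfin, mul_assoc _ (ENNReal.ofReal (Real.exp _)) _,
          ← ENNReal.ofReal_mul (Real.exp_nonneg _), ← Real.exp_add]
        have hsum : -(ENNReal.ofReal lamp * volume (D ∩ C)).toReal +
            -(ENNReal.ofReal lamp * volume (C \ D)).toReal =
            -(ENNReal.ofReal lamp * volume C).toReal := by
          rw [← neg_add, ← ENNReal.toReal_add
            (ENNReal.mul_ne_top ENNReal.ofReal_ne_top hI.ne)
            (ENNReal.mul_ne_top ENNReal.ofReal_ne_top hCD.ne), ← mul_add, inter_comm,
            measure_inter_add_sdiff _ hD]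
        rw [hsum, ← add_mul, ← mul_add, add_comm (volume (D \ C)), measure_inter_add_sdiff _ hC]

/-- The Mecke formula for the unmarked Poisson process. -/
theorem poisson_satisfiesMecke [IsProbabilityMeasure P] (hlamp : 0 < lamp)
    (hX : IsPoissonProcess P lamp X) :
    SatisfiesMecke P (ENNReal.ofReal lamp • (volume : Measure Plane)) X := by
  have hne : ENNReal.ofReal lamp ≠ 0 := by simpa using hlamp
  have hfin : ∀ B : Set Plane, (ENNReal.ofReal lamp • (volume : Measure Plane)) B < ∞ →
      volume B < ∞ := by
    intro B hB
    rw [Measure.smul_apply, smul_eq_mul] at hB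
    exact lt_top_iff_ne_top.2 fun h => by simp [h, ENNReal.mul_top hne] at hB
  have : SigmaFinite (ENNReal.ofReal lamp • (volume : Measure Plane)) :=
    inferInstanceAs (SigmaFinite (lamp.toNNReal • (volume : Measure Plane)))
  refine satisfiesMecke_of_void hX.measurable (poisson_ae_injective hX) fun D C hD hC hDf hCf => ?_
  exact poisson_campbell_void hX hD hC (hfin D hDf) (hfin C hCf)

/-- The law of the Poisson process is determined by its intensity. -/
theorem poisson_law_unique [IsProbabilityMeasure P] {Ω' : Type*} [MeasurableSpace Ω']
    {P' : Measure Ω'} [IsProbabilityMeasure P'] {X' : ℕ → Ω' → Plane}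
    (hX : IsPoissonProcess P lamp X) (hX' : IsPoissonProcess P' lamp X') :
    (P.map fun ω => allPoints fun i => X i ω) = P'.map fun ω => allPoints fun i => X' i ω := by
  have hm := measurable_allPoints hX.measurable
  have hm' := measurable_allPoints hX'.measurable
  have : IsProbabilityMeasure (P.map fun ω => allPoints fun i => X i ω) :=
    Measure.isProbabilityMeasure_map hm.aemeasurable
  refine ext_of_voidEvent volume
    (carriedBySimple_map hm ((poisson_ae_injective hX).mono fun ω h => isSimple_allPoints h))
    (carriedBySimple_map hm' ((poisson_ae_injective hX').mono fun ω h => isSimple_allPoints h))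
    fun C hC hCfin => ?_
  rw [Measure.map_apply hm (measurableSet_voidEvent hC),
    Measure.map_apply hm' (measurableSet_voidEvent hC)]
  exact (poisson_void hX hC hCfin).trans (poisson_void hX' hC hCfin).symm

end Unmarked

/-! ### The marked Poisson process -/

/-- The function `x ↦ exp (-x)` on the extended half line. -/
noncomputable def negExp (x : ℝ≥0∞) : ℝ≥0∞ := EReal.exp (-(x : EReal))

/-- The function `q ↦ -log q` on the unit interval. -/
noncomputable def negLog (q : ℝ≥0∞) : ℝ≥0∞ := (-(ENNReal.log q)).toENNReal

theorem negExp_negLog {q : ℝ≥0∞} (hq : q ≤ 1) : negExp (negLog q) = q := by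
  have : 0 ≤ -(ENNReal.log q) := by
    rw [EReal.neg_nonneg, ENNReal.log_le_zero_iff]
    exact hq
  rw [negExp, negLog, EReal.coe_toENNReal this, neg_neg, ENNReal.exp_log]

theorem negExp_zero : negExp 0 = 1 := by simp [negExp]

theorem negExp_add (x y : ℝ≥0∞) : negExp (x + y) = negExp x * negExp y := by
  have h : ∀ z : ℝ≥0∞, EReal.exp (z : EReal) ≠ 0 := fun z => by
    rw [Ne, EReal.exp_eq_zero_iff]
    exact EReal.coe_ennreal_ne_bot z
  rw [negExp, negExp, negExp, EReal.exp_neg, EReal.exp_neg, EReal.exp_neg, EReal.coe_ennreal_add,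
    EReal.exp_add, ENNReal.mul_inv (Or.inl (h x)) (Or.inr (h y))]

theorem negExp_sum {ι : Type*} (s : Finset ι) (f : ι → ℝ≥0∞) :
    negExp (∑ i ∈ s, f i) = ∏ i ∈ s, negExp (f i) := by
  classical
  induction s using Finset.induction_on with
  | empty => simp [negExp_zero]
  | insert a s ha ih => rw [Finset.sum_insert ha, Finset.prod_insert ha, negExp_add, ih]

theorem continuous_negExp : Continuous negExp := by
  unfold negExp
  exact ENNReal.continuous_exp.comp (continuous_neg.comp continuous_coe_ennreal_ereal)

theorem measurable_negLog : Measurable negLog := by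
  unfold negLog
  exact measurable_ereal_toENNReal.comp (continuous_neg.measurable.comp ENNReal.measurable_log)

/-- Rewrites a product of conditional probabilities, one for each point, as a function of an
integral against the counting measure. The result depends on the configuration and not on its
enumeration, as the Mecke formula requires. Vanishing factors are covered because the exponent may
be infinite. -/
theorem negExp_tsum {ι : Type*} (f : ι → ℝ≥0∞) : ∏' i, negExp (f i) = negExp (∑' i, f i) := by
  have h : HasProd (fun i => negExp (f i)) (negExp (∑' i, f i)) := by
    have := (continuous_negExp.tendsto _).comp (ENNReal.summable (f := f)).hasSum
    refine this.congr fun s => ?_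
    exact negExp_sum s f
  exact h.tprod_eq

/-- The uniform distribution of the orientations. -/
noncomputable def markLaw : Measure ℝ := ProbabilityTheory.cond volume (Icc 0 (2 * Real.pi))

instance isProbabilityMeasure_markLaw : IsProbabilityMeasure markLaw :=
  cond_isProbabilityMeasure_of_finite (by simp [Real.pi_pos]) measure_Icc_lt_top.ne

theorem markLaw_eq : markLaw =
    (ENNReal.ofReal (2 * Real.pi))⁻¹ • (volume : Measure ℝ).restrict (Icc 0 (2 * Real.pi)) := by
  simp [markLaw, ProbabilityTheory.cond]

/-- Probability that no marked point lies in `C`, given the positions of the points. -/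
noncomputable def voidGiven (C : Set (Plane × ℝ)) (φ : Measure Plane) : ℝ≥0∞ :=
  negExp (∫⁻ x, negLog (markLaw {t | (x, t) ∉ C}) ∂φ)

theorem measurable_section {C : Set (Plane × ℝ)} (hC : MeasurableSet C) :
    Measurable fun x : Plane => markLaw {t | (x, t) ∈ C} :=
  measurable_measure_prodMk_left hC

theorem measurable_negLog_section {C : Set (Plane × ℝ)} (hC : MeasurableSet C) :
    Measurable fun x : Plane => negLog (markLaw {t | (x, t) ∉ C}) :=
  measurable_negLog.comp (measurable_section hC.compl)

theorem measurable_voidGiven {C : Set (Plane × ℝ)} (hC : MeasurableSet C) :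
    Measurable (voidGiven C) :=
  continuous_negExp.measurable.comp
    (Measure.measurable_lintegral (measurable_negLog_section hC))

theorem infinitePi_all_notMem {C : Set (Plane × ℝ)} (hC : MeasurableSet C) (x : ℕ → Plane) :
    Measure.infinitePi (fun _ : ℕ => markLaw) {t | ∀ j, (x j, t j) ∉ C} =
      voidGiven C (allPoints x) := by
  have h1 : {t : ℕ → ℝ | ∀ j, (x j, t j) ∉ C} = univ.pi fun j => {t | (x j, t) ∉ C} := by
    ext t; simp
  have hm : ∀ j, MeasurableSet {t | (x j, t) ∉ C} := fun j => measurable_prodMk_left hC.compl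
  rw [h1, Measure.infinitePi_pi_univ _ hm, voidGiven,
    lintegral_allPoints x (measurable_negLog_section hC), ← negExp_tsum]
  exact tprod_congr fun j => (negExp_negLog prob_le_one).symm

/-- Given the positions, the marks are independent. The factor of index `i` is split off, and the
others form the conditional void probability of the remaining configuration. -/
theorem infinitePi_other_notMem {C D : Set (Plane × ℝ)} (hC : MeasurableSet C)
    (hD : MeasurableSet D) (x : ℕ → Plane) (i : ℕ) :
    Measure.infinitePi (fun _ : ℕ => markLaw)
      {t | (x i, t i) ∈ D ∧ ∀ j, j ≠ i → (x j, t j) ∉ C} =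
      markLaw {t | (x i, t) ∈ D} * voidGiven C (otherPoints x i) := by
  classical
  set S : ℕ → Set ℝ := fun j => if j = i then {t | (x i, t) ∈ D} else {t | (x j, t) ∉ C} with hS
  have h1 : {t : ℕ → ℝ | (x i, t i) ∈ D ∧ ∀ j, j ≠ i → (x j, t j) ∉ C} = univ.pi S := by
    ext t
    simp only [mem_ofPred_eq, mem_pi, mem_univ, forall_const, hS]
    constructor
    · intro h j
      split_ifs with hj
      · subst hj; exact h.1
      · exact h.2 j hj
    · intro h
      refine ⟨by simpa using h i, fun j hj => by simpa [hj] using h j⟩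
  have hm : ∀ j, MeasurableSet (S j) := by
    intro j
    simp only [hS]
    split_ifs
    · exact measurable_prodMk_left hD
    · exact measurable_prodMk_left hC.compl
  rw [h1, Measure.infinitePi_pi_univ _ hm, voidGiven, otherPoints,
    lintegral_sum_dirac (fun j : ({i}ᶜ : Set ℕ) => x j)
      (measurable_negLog_section hC)]
  have h2 : ∏' j, markLaw (S j) = negExp (∑' j, negLog (markLaw (S j))) := by
    rw [← negExp_tsum]
    exact tprod_congr fun j => (negExp_negLog prob_le_one).symm
  have h3 : ∑' j, negLog (markLaw (S j)) = negLog (markLaw {t | (x i, t) ∈ D}) +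
      ∑' j : ({i}ᶜ : Set ℕ), negLog (markLaw {t | (x j, t) ∉ C}) := by
    rw [← ENNReal.summable.tsum_add_tsum_compl (s := {i}) ENNReal.summable]
    congr 1
    · rw [tsum_singleton i fun j => negLog (markLaw (S j))]
      simp [hS]
    · refine tsum_congr fun j => ?_
      have : (j : ℕ) ≠ i := j.2
      simp [hS, this]
  rw [h2, h3, negExp_add, negExp_negLog prob_le_one]

section Marked

theorem measurable_pair {Ω : Type*} [MeasurableSpace Ω] {P : Measure Ω} {lamp : ℝ}
    {X : ℕ → Ω → Plane} {Θ : ℕ → Ω → ℝ} (hX : IsPoissonBipolar P lamp X Θ) (i : ℕ) :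
    Measurable fun ω => (X i ω, Θ i ω) :=
  (hX.poisson.measurable i).prodMk (hX.measurable_mark i)

variable {Ω : Type*} [MeasurableSpace Ω] {P : Measure Ω} [IsProbabilityMeasure P] {lamp : ℝ}
  {X : ℕ → Ω → Plane} {Θ : ℕ → Ω → ℝ}

/-- The sequences of positions and of marks are independent and the marks are iid, so the joint law
is a product with an infinite product measure; Fubini then conditions on the positions. -/
theorem bipolar_measure_eq_lintegral (hX : IsPoissonBipolar P lamp X Θ)
    {S : Set ((ℕ → Plane) × (ℕ → ℝ))} (hS : MeasurableSet S) :
    P {ω | ((fun i => X i ω), fun i => Θ i ω) ∈ S} =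
      ∫⁻ ω, Measure.infinitePi (fun _ : ℕ => markLaw) {t | ((fun i => X i ω), t) ∈ S} ∂P := by
  have hmX : Measurable fun ω i => X i ω := measurable_pi_lambda _ hX.poisson.measurable
  have hmΘ : Measurable fun ω i => Θ i ω := measurable_pi_lambda _ hX.measurable_mark
  have h1 := (indepFun_iff_map_prod_eq_prod_map_map hmX.aemeasurable hmΘ.aemeasurable).1
    hX.indep_points_marks
  have h2 : P.map (fun ω i => Θ i ω) = Measure.infinitePi fun _ : ℕ => markLaw := by
    rw [hX.indep_mark.map_fun_eq_infinitePi_map hX.measurable_mark]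
    congr 1
    funext i
    exact hX.uniform_mark i
  have h3 : P {ω | ((fun i => X i ω), fun i => Θ i ω) ∈ S} =
      P.map (fun ω => ((fun i => X i ω), fun i => Θ i ω)) S :=
    (Measure.map_apply (hmX.prodMk hmΘ) hS).symm
  rw [h3, h1, h2, Measure.prod_apply hS, lintegral_map (measurable_measure_prodMk_left hS) hmX]
  rfl

theorem bipolar_void (hX : IsPoissonBipolar P lamp X Θ) {C : Set (Plane × ℝ)}
    (hC : MeasurableSet C) :
    P {ω | ∀ j, (X j ω, Θ j ω) ∉ C} = ∫⁻ ω, voidGiven C (allPoints fun i => X i ω) ∂P := by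
  have hS : MeasurableSet {q : (ℕ → Plane) × (ℕ → ℝ) | ∀ j, (q.1 j, q.2 j) ∉ C} := by
    have : {q : (ℕ → Plane) × (ℕ → ℝ) | ∀ j, (q.1 j, q.2 j) ∉ C} =
        ⋂ j, (fun q : (ℕ → Plane) × (ℕ → ℝ) => (q.1 j, q.2 j)) ⁻¹' Cᶜ := by
      ext q; simp
    rw [this]
    exact MeasurableSet.iInter fun j => (by fun_prop : Measurable
      fun q : (ℕ → Plane) × (ℕ → ℝ) => (q.1 j, q.2 j)) hC.compl
  refine (bipolar_measure_eq_lintegral hX hS).trans (lintegral_congr fun ω => ?_)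
  exact infinitePi_all_notMem hC _

theorem bipolar_other_void (hX : IsPoissonBipolar P lamp X Θ) {C D : Set (Plane × ℝ)}
    (hC : MeasurableSet C) (hD : MeasurableSet D) (i : ℕ) :
    P {ω | (X i ω, Θ i ω) ∈ D ∧ ∀ j, j ≠ i → (X j ω, Θ j ω) ∉ C} =
      ∫⁻ ω, markLaw {t | (X i ω, t) ∈ D} * voidGiven C (otherPoints (fun j => X j ω) i) ∂P := by
  have hmeas : ∀ j, Measurable fun q : (ℕ → Plane) × (ℕ → ℝ) => (q.1 j, q.2 j) := fun j => by
    fun_prop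
  have hS : MeasurableSet {q : (ℕ → Plane) × (ℕ → ℝ) |
      (q.1 i, q.2 i) ∈ D ∧ ∀ j, j ≠ i → (q.1 j, q.2 j) ∉ C} := by
    have : {q : (ℕ → Plane) × (ℕ → ℝ) | (q.1 i, q.2 i) ∈ D ∧ ∀ j, j ≠ i → (q.1 j, q.2 j) ∉ C} =
        (fun q : (ℕ → Plane) × (ℕ → ℝ) => (q.1 i, q.2 i)) ⁻¹' D ∩
        ⋂ j, ⋂ (_ : j ≠ i), (fun q : (ℕ → Plane) × (ℕ → ℝ) => (q.1 j, q.2 j)) ⁻¹' Cᶜ := by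
      ext q; simp
    rw [this]
    exact (hmeas i hD).inter (MeasurableSet.iInter fun j => MeasurableSet.iInter fun _ =>
      hmeas j hC.compl)
  refine (bipolar_measure_eq_lintegral hX hS).trans (lintegral_congr fun ω => ?_)
  exact infinitePi_other_notMem hC hD _ i

theorem bipolar_ae_injective (hX : IsPoissonBipolar P lamp X Θ) :
    ∀ᵐ ω ∂P, Function.Injective fun i => (X i ω, Θ i ω) := by
  filter_upwards [poisson_ae_injective hX.poisson] with ω hω i j hij
  exact hω (congrArg Prod.fst hij)

instance sigmaFinite_ofReal_smul_volume (lamp : ℝ) :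
    SigmaFinite (ENNReal.ofReal lamp • (volume : Measure Plane)) :=
  inferInstanceAs (SigmaFinite (lamp.toNNReal • (volume : Measure Plane)))

/-- The intensity measure of the marked Poisson process. -/
noncomputable def bipolarIntensity (lamp : ℝ) : Measure (Plane × ℝ) :=
  (ENNReal.ofReal lamp • (volume : Measure Plane)).prod markLaw

instance sigmaFinite_bipolarIntensity (lamp : ℝ) : SigmaFinite (bipolarIntensity lamp) := by
  unfold bipolarIntensity; infer_instance

/-- The Mecke formula for the marked Poisson process. -/
theorem bipolar_satisfiesMecke (hlamp : 0 < lamp) (hX : IsPoissonBipolar P lamp X Θ) :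
    SatisfiesMecke P (bipolarIntensity lamp) fun i ω => (X i ω, Θ i ω) := by
  refine satisfiesMecke_of_void (measurable_pair hX) (bipolar_ae_injective hX)
    fun D C hD hC _ _ => ?_
  simp_rw [bipolar_other_void hX hC hD]
  have hF : Measurable fun z : Plane × Measure Plane =>
      markLaw {t | (z.1, t) ∈ D} * voidGiven C z.2 :=
    ((measurable_section hD).comp measurable_fst).mul
      ((measurable_voidGiven hC).comp measurable_snd)
  -- Once the marks are integrated out, the void condition is a functional of a position and the
  -- remaining positions, to which the unmarked Mecke formula applies.
  refine (poisson_satisfiesMecke hlamp hX.poisson _ hF).trans ?_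
  have hall : Measurable fun ω => voidGiven C (allPoints fun j => X j ω) :=
    (measurable_voidGiven hC).comp (measurable_allPoints hX.poisson.measurable)
  simp only [lintegral_const_mul _ hall]
  rw [lintegral_mul_const _ (measurable_section hD), ← bipolar_void hX hC, bipolarIntensity,
    Measure.prod_apply hD]
  rfl

theorem bipolar_map_voidEvent (hX : IsPoissonBipolar P lamp X Θ) {C : Set (Plane × ℝ)}
    (hC : MeasurableSet C) :
    (P.map fun ω => allPoints fun i => (X i ω, Θ i ω)) (voidEvent C) =
      ∫⁻ φ, voidGiven C φ ∂(P.map fun ω => allPoints fun i => X i ω) := by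
  rw [Measure.map_apply (measurable_allPoints (measurable_pair hX)) (measurableSet_voidEvent hC),
    lintegral_map (measurable_voidGiven hC) (measurable_allPoints hX.poisson.measurable),
    ← bipolar_void hX hC]
  congr 1
  ext ω
  exact allPoints_eq_zero_iff _ hC

/-- The law of the marked Poisson process is determined by its intensity. -/
theorem bipolar_law_unique {Ω' : Type*} [MeasurableSpace Ω']
    {P' : Measure Ω'} [IsProbabilityMeasure P'] {X' : ℕ → Ω' → Plane} {Θ' : ℕ → Ω' → ℝ}
    (hX : IsPoissonBipolar P lamp X Θ) (hX' : IsPoissonBipolar P' lamp X' Θ') :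
    (P.map fun ω => allPoints fun i => (X i ω, Θ i ω)) =
      P'.map fun ω => allPoints fun i => (X' i ω, Θ' i ω) := by
  have hm := measurable_allPoints (measurable_pair hX)
  have hm' := measurable_allPoints (measurable_pair hX')
  have : IsProbabilityMeasure (P.map fun ω => allPoints fun i => (X i ω, Θ i ω)) :=
    Measure.isProbabilityMeasure_map hm.aemeasurable
  refine ext_of_voidEvent (bipolarIntensity lamp)
    (carriedBySimple_map hm ((bipolar_ae_injective hX).mono fun ω h => isSimple_allPoints h))
    (carriedBySimple_map hm' ((bipolar_ae_injective hX').mono fun ω h => isSimple_allPoints h))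
    fun C hC _ => ?_
  rw [bipolar_map_voidEvent hX hC, bipolar_map_voidEvent hX' hC,
    poisson_law_unique hX.poisson hX'.poisson]

end Marked

/-! ### Invariance under rigid motions -/

/-- Both intervals are fundamental domains for the translations by multiples of `T`. -/
theorem setLIntegral_Ioc_of_periodic {f : ℝ → ℝ≥0∞} {T : ℝ} (hT : 0 < T)
    (hf : Function.Periodic f T) (a b : ℝ) :
    ∫⁻ t in Ioc a (a + T), f t = ∫⁻ t in Ioc b (b + T), f t := by
  have : VAddInvariantMeasure (AddSubgroup.zmultiples T) ℝ volume :=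
    ⟨fun c s _ => measure_preimage_add _ _ _⟩
  exact (isAddFundamentalDomain_Ioc hT a).setLIntegral_eq (isAddFundamentalDomain_Ioc hT b) f
    hf.map_vadd_zmultiples

/-- The orientation `t` modulo `2π`. -/
noncomputable abbrev angleMod (t : ℝ) : ℝ := toIcoMod Real.two_pi_pos 0 t

theorem measurable_angleMod : Measurable angleMod := by
  have : angleMod = fun t => Int.fract (t / (2 * Real.pi)) * (2 * Real.pi) := by
    funext t
    rw [angleMod, toIcoMod_eq_add_fract_mul]
    simp
  rw [this]
  fun_prop

theorem periodic_angleMod : Function.Periodic angleMod (2 * Real.pi) :=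
  toIcoMod_periodic Real.two_pi_pos 0

theorem angleMod_eq_self {t : ℝ} (ht : t ∈ Ico 0 (2 * Real.pi)) : angleMod t = t := by
  rw [angleMod, toIcoMod_eq_self]
  simpa using ht

theorem angleMod_add_angleMod (s t : ℝ) : angleMod (angleMod s + t) = angleMod (s + t) := by
  have : angleMod s = s - toIcoDiv Real.two_pi_pos 0 s • (2 * Real.pi) := rfl
  rw [this, sub_add_eq_add_sub]
  exact toIcoMod_sub_zsmul _ _ _ _

theorem polar_angleMod (d t : ℝ) : polar d (angleMod t) = polar d t := by
  have : angleMod t = t - toIcoDiv Real.two_pi_pos 0 t * (2 * Real.pi) := by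
    rw [angleMod, toIcoMod, zsmul_eq_mul]
  rw [polar, polar, this, Real.cos_sub_int_mul_two_pi, Real.sin_sub_int_mul_two_pi]

theorem lintegral_markLaw (f : ℝ → ℝ≥0∞) :
    ∫⁻ t, f t ∂markLaw =
      (ENNReal.ofReal (2 * Real.pi))⁻¹ * ∫⁻ t in Icc 0 (2 * Real.pi), f t := by
  rw [markLaw_eq, lintegral_smul_measure, smul_eq_mul]

theorem setLIntegral_Icc_of_periodic {f : ℝ → ℝ≥0∞} (hf : Function.Periodic f (2 * Real.pi))
    (a : ℝ) : ∫⁻ t in Icc 0 (2 * Real.pi), f t = ∫⁻ t in Ioc a (a + 2 * Real.pi), f t := by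
  rw [← setLIntegral_Ioc_of_periodic Real.two_pi_pos hf 0 a, zero_add,
    setLIntegral_congr Ioc_ae_eq_Icc]

theorem setLIntegral_Icc_add_of_periodic {f : ℝ → ℝ≥0∞} (hm : Measurable f)
    (hf : Function.Periodic f (2 * Real.pi)) (α : ℝ) :
    ∫⁻ t in Icc 0 (2 * Real.pi), f (t + α) = ∫⁻ t in Icc 0 (2 * Real.pi), f t := by
  have h1 : Function.Periodic (fun t => f (t + α)) (2 * Real.pi) := fun t => by
    simp only [add_right_comm t, hf (t + α)]
  rw [setLIntegral_Icc_of_periodic h1 0, setLIntegral_Icc_of_periodic hf α]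
  have := (measurePreserving_add_right (volume : Measure ℝ) α).setLIntegral_comp_preimage
    (s := Ioc α (α + 2 * Real.pi)) measurableSet_Ioc hm
  rw [← this]
  congr 2
  ext t
  simp only [mem_preimage, mem_Ioc]
  constructor <;> rintro ⟨h, h'⟩ <;> constructor <;> linarith

/-- The indicator of a set of reduced angles is periodic, so shifting by `α` keeps its integral over
a period. The endpoint `2π`, where reduction is not the identity, is a null set. -/
theorem markLaw_map_rotate (α : ℝ) : markLaw.map (fun t => angleMod (t + α)) = markLaw := by
  ext S hS
  have hm : Measurable fun t : ℝ => angleMod (t + α) := measurable_angleMod.comp (by fun_prop)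
  rw [← lintegral_indicator_one hS, ← lintegral_indicator_one hS,
    lintegral_map (measurable_one.indicator hS) hm, lintegral_markLaw, lintegral_markLaw]
  congr 1
  have hp : Function.Periodic (fun t => S.indicator (1 : ℝ → ℝ≥0∞) (angleMod t)) (2 * Real.pi) :=
    fun t => by simp only [periodic_angleMod t]
  refine (setLIntegral_Icc_add_of_periodic
    ((measurable_one.indicator hS).comp measurable_angleMod) hp α).trans ?_
  rw [← setLIntegral_congr Ico_ae_eq_Icc, ← setLIntegral_congr Ico_ae_eq_Icc]
  exact setLIntegral_congr_fun measurableSet_Ico fun t ht => by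
    simp only [Function.comp_apply, angleMod_eq_self ht]

/-- Rotation of the plane about the origin by the angle `α`. -/
noncomputable def rotatePlane (α : ℝ) (y : Plane) : Plane :=
  !₂[Real.cos α * y 0 - Real.sin α * y 1, Real.sin α * y 0 + Real.cos α * y 1]

theorem rotatePair_eq (α : ℝ) (p : Plane × ℝ) :
    rotatePair α p = (rotatePlane α p.1, angleMod (p.2 + α)) := rfl

theorem rotatePlane_rotatePlane (α β : ℝ) (y : Plane) :
    rotatePlane α (rotatePlane β y) = rotatePlane (α + β) y := by
  ext i
  fin_cases i <;> simp [rotatePlane, Real.cos_add, Real.sin_add] <;> ring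

theorem rotatePlane_zero (y : Plane) : rotatePlane 0 y = y := by
  ext i
  fin_cases i <;> simp [rotatePlane]

theorem rotatePlane_polar (α r φ : ℝ) : rotatePlane α (polar r φ) = polar r (φ + α) := by
  ext i
  fin_cases i <;> simp [rotatePlane, polar, Real.cos_add, Real.sin_add] <;> ring

/-- Rotation of the plane as a linear isometry. -/
noncomputable def rotation (α : ℝ) : Plane ≃ₗᵢ[ℝ] Plane where
  toFun := rotatePlane α
  invFun := rotatePlane (-α)
  left_inv y := by rw [rotatePlane_rotatePlane, neg_add_cancel, rotatePlane_zero]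
  right_inv y := by rw [rotatePlane_rotatePlane, add_neg_cancel, rotatePlane_zero]
  map_add' x y := by
    ext i
    fin_cases i <;> simp [rotatePlane] <;> ring
  map_smul' c x := by
    ext i
    fin_cases i <;> simp [rotatePlane] <;> ring
  norm_map' y := by
    rw [EuclideanSpace.norm_eq, EuclideanSpace.norm_eq]
    congr 1
    simp only [Fin.sum_univ_two, Real.norm_eq_abs, sq_abs]
    have := Real.sin_sq_add_cos_sq α
    simp [rotatePlane]
    linear_combination (y 0 ^ 2 + y 1 ^ 2) * this

/-- The rigid motion of marked points which moves the origin with orientation `0` to the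
pair `p`. -/
noncomputable def moveTo (p q : Plane × ℝ) : Plane × ℝ :=
  (rotation p.2 q.1 + p.1, angleMod (q.2 + p.2))

theorem measurable_rotatePair : Measurable fun z : ℝ × (Plane × ℝ) => rotatePair z.1 z.2 := by
  have h1 : Measurable fun z : ℝ × (Plane × ℝ) => rotatePlane z.1 z.2.1 := by
    unfold rotatePlane
    fun_prop
  have h2 : Measurable fun z : ℝ × (Plane × ℝ) => angleMod (z.2.2 + z.1) :=
    measurable_angleMod.comp (by fun_prop)
  exact h1.prodMk h2

section

variable {Ω : Type*} [MeasurableSpace Ω] {P : Measure Ω} {lamp : ℝ}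
  {X : ℕ → Ω → Plane} {Θ : ℕ → Ω → ℝ}

theorem isPoissonProcess_comp (hX : IsPoissonProcess P lamp X) {g : Plane → Plane}
    (hg : MeasurePreserving g volume volume) : IsPoissonProcess P lamp fun i ω => g (X i ω) := by
  have hcount : ∀ {B : Set Plane}, MeasurableSet B →
      (fun ω => Measure.sum (fun i => Measure.dirac (g (X i ω))) B) =
        fun ω => Measure.sum (fun i => Measure.dirac (X i ω)) (g ⁻¹' B) := by
    intro B hB
    funext ω
    rw [sum_dirac_apply _ hB, sum_dirac_apply _ (hg.measurable hB)]
    rfl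
  have hvol : ∀ {B : Set Plane}, MeasurableSet B → volume (g ⁻¹' B) = volume B := fun hB =>
    hg.measure_preimage hB.nullMeasurableSet
  refine ⟨fun i => hg.measurable.comp (hX.measurable i), fun B hB hfin => ?_,
    fun n B hB hfin hdis => ?_⟩
  · rw [hcount hB, ← hvol hB]
    exact hX.hasLaw_count _ (hg.measurable hB) (by rwa [hvol hB])
  · have hc : (fun k ω => Measure.sum (fun i => Measure.dirac (g (X i ω))) (B k)) =
        fun k ω => Measure.sum (fun i => Measure.dirac (X i ω)) (g ⁻¹' B k) :=
      funext fun k => hcount (hB k)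
    rw [hc]
    exact hX.indep_count n (fun k => g ⁻¹' B k) (fun k => hg.measurable (hB k))
      (fun k => by rw [hvol (hB k)]; exact hfin k) (fun k m hkm => (hdis hkm).preimage g)

/-- Rigid motions preserve area, a uniform orientation stays uniform after a shift modulo `2π`, and
positions and marks are transformed separately, which preserves their independence. -/
theorem isPoissonBipolar_moveTo (hX : IsPoissonBipolar P lamp X Θ) (p : Plane × ℝ) :
    IsPoissonBipolar P lamp (fun i ω => (moveTo p (X i ω, Θ i ω)).1)
      fun i ω => (moveTo p (X i ω, Θ i ω)).2 := by
  have hm : Measurable fun t : ℝ => angleMod (t + p.2) := measurable_angleMod.comp (by fun_prop)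
  have hmp : MeasurePreserving (fun y : Plane => rotation p.2 y + p.1) volume volume :=
    (measurePreserving_add_right volume p.1).comp (rotation p.2).measurePreserving
  refine ⟨isPoissonProcess_comp hX.poisson hmp, fun i => hm.comp (hX.measurable_mark i),
    fun i => ?_, hX.indep_mark.comp _ fun _ => hm, ?_⟩
  · have := hX.uniform_mark i
    rw [pdf.IsUniform] at this ⊢
    have h2 := Measure.map_map hm (hX.measurable_mark i) (μ := P)
    rw [this] at h2
    exact h2.symm.trans (markLaw_map_rotate p.2)
  · exact hX.indep_points_marks.comp
      (φ := fun x : ℕ → Plane => fun i => rotation p.2 (x i) + p.1)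
      (ψ := fun t : ℕ → ℝ => fun i => angleMod (t i + p.2))
      (by fun_prop) (measurable_pi_lambda _ fun i => hm.comp (measurable_pi_apply i))

/-- The law of the marked Poisson process is invariant under rigid motions. -/
theorem bipolar_law_moveTo [IsProbabilityMeasure P] (hX : IsPoissonBipolar P lamp X Θ)
    (p : Plane × ℝ) :
    (P.map fun ω => allPoints fun i => moveTo p (X i ω, Θ i ω)) =
      P.map fun ω => allPoints fun i => (X i ω, Θ i ω) :=
  bipolar_law_unique (isPoissonBipolar_moveTo hX p) hX

end

/-! ### Configurations seen from a pair as measurable functions of the configuration -/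

/-- Marked points whose transmitter lies in the annulus of index `n`. -/
def annulus (n : ℕ) : Set (Plane × ℝ) := {q | ⌊‖q.1‖⌋₊ = n}

theorem measurableSet_annulus (n : ℕ) : MeasurableSet (annulus n) := by
  have : Measurable fun q : Plane × ℝ => ⌊‖q.1‖⌋₊ := Nat.measurable_floor.comp (by fun_prop)
  exact this (measurableSet_singleton n)

theorem pairwise_disjoint_annulus : Pairwise (Function.onFun Disjoint annulus) :=
  fun _ _ h => Set.disjoint_left.2 fun _ hx hx' => h (hx.symm.trans hx')

theorem iUnion_annulus : ⋃ n, annulus n = univ := by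
  ext q; simp [annulus]

/-- Configurations with finitely many points in bounded regions. -/
def IsLocallyFinite (φ : Config) : Prop := ∀ n, φ (annulus n) < ∞

open Classical in
/-- The restriction of a configuration to the annulus of index `n.1`, if the number of its points
there has integer part `n.2`. -/
noncomputable def truncation (n : ℕ × ℕ) : Kernel Config (Plane × ℝ) where
  toFun φ := if φ (annulus n.1) < ∞ ∧ ⌊(φ (annulus n.1)).toNNReal⌋₊ = n.2 then
    φ.restrict (annulus n.1) else 0
  measurable' := by
    have h : Measurable fun φ : Config => φ (annulus n.1) :=
      Measure.measurable_coe (measurableSet_annulus n.1)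
    refine Measurable.ite ?_ ?_ measurable_const
    · exact (h measurableSet_Iio).inter
        ((Nat.measurable_floor.comp h.ennreal_toNNReal) (measurableSet_singleton n.2))
    · refine Measure.measurable_of_measurable_coe _ fun A hA => ?_
      simp_rw [Measure.restrict_apply hA]
      exact Measure.measurable_coe (hA.inter (measurableSet_annulus n.1))

/-- Fixing the integer part of the mass is what bounds the kernel uniformly in `φ`; restriction to
an annulus alone would not. -/
instance isFiniteKernel_truncation (n : ℕ × ℕ) : IsFiniteKernel (truncation n) := by
  refine ⟨n.2 + 1, by simp, fun φ => ?_⟩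
  change (if φ (annulus n.1) < ∞ ∧ ⌊(φ (annulus n.1)).toNNReal⌋₊ = n.2 then
    φ.restrict (annulus n.1) else 0) univ ≤ _
  split_ifs with h
  · rw [Measure.restrict_apply_univ, ← ENNReal.coe_toNNReal h.1.ne, ← h.2]
    exact_mod_cast (Nat.lt_floor_add_one _).le
  · simp

/-- An s-finite kernel which maps a locally finite configuration to itself. -/
noncomputable def configKernel : Kernel Config (Plane × ℝ) := Kernel.sum truncation

instance isSFiniteKernel_configKernel : IsSFiniteKernel configKernel := by
  unfold configKernel; infer_instance

/-- Evaluating a measure at a set that varies with parameters is jointly measurable for s-finite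
kernels. `configKernel` provides this for configurations, and on the locally finite ones it changes
nothing: in each annulus exactly one truncation is active. -/
theorem configKernel_apply {φ : Config} (hφ : IsLocallyFinite φ) : configKernel φ = φ := by
  ext A hA
  rw [configKernel, Kernel.sum_apply, Measure.sum_apply _ hA, ENNReal.tsum_prod']
  have h : ∀ n, ∑' m, truncation (n, m) φ A = φ (A ∩ annulus n) := by
    intro n
    rw [tsum_eq_single ⌊(φ (annulus n)).toNNReal⌋₊]
    · change (if φ (annulus n) < ∞ ∧ _ then φ.restrict (annulus n) else 0) A = _
      rw [if_pos ⟨hφ n, rfl⟩, Measure.restrict_apply hA]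
    · intro m hm
      change (if φ (annulus n) < ∞ ∧ _ then φ.restrict (annulus n) else 0) A = _
      rw [if_neg fun h => hm h.2.symm]
      rfl
  simp_rw [h]
  rw [← measure_iUnion (fun i j hij => (pairwise_disjoint_annulus hij).mono inter_subset_right
    inter_subset_right) fun n => hA.inter (measurableSet_annulus n), ← inter_iUnion,
    iUnion_annulus, inter_univ]

/-! ### Measurability of zone counts and of the surviving points -/

section Zones

variable (d Rcs Rtx : ℝ)

theorem measurableSet_mem_zone :
    MeasurableSet {z : (Plane × ℝ) × Plane | z.2 ∈ zone d Rcs Rtx z.1.1 z.1.2} := by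
  have h : {z : (Plane × ℝ) × Plane | z.2 ∈ zone d Rcs Rtx z.1.1 z.1.2} =
      {z | dist z.2 z.1.1 ≤ Rcs} ∪ {z | dist z.2 (receiver d z.1.1 z.1.2) ≤ Rtx} := by
    ext z; simp [zone]
  have hp : Measurable fun z : (Plane × ℝ) × Plane => receiver d z.1.1 z.1.2 := by
    unfold receiver polar
    fun_prop
  rw [h]
  exact (measurableSet_le (by fun_prop) measurable_const).union
    (measurableSet_le (measurable_snd.dist hp) measurable_const)

theorem measurableSet_zone (x : Plane) (θ : ℝ) : MeasurableSet (zone d Rcs Rtx x θ) :=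
  measurableSet_closedBall.union measurableSet_closedBall

/-- Marked points whose transmitter lies in the exclusion zone of the pair `p`. -/
def zonePoints (p : Plane × ℝ) : Set (Plane × ℝ) := {q | q.1 ∈ zone d Rcs Rtx p.1 p.2}

theorem measurableSet_zonePoints (p : Plane × ℝ) : MeasurableSet (zonePoints d Rcs Rtx p) :=
  measurable_fst (measurableSet_zone d Rcs Rtx p.1 p.2)

theorem measurable_zoneCount :
    Measurable fun z : Config × (Plane × ℝ) => configKernel z.1 (zonePoints d Rcs Rtx z.2) := by
  have hS : MeasurableSet {w : (Config × (Plane × ℝ)) × (Plane × ℝ) |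
      w.2.1 ∈ zone d Rcs Rtx w.1.2.1 w.1.2.2} := by
    have hm : Measurable fun w : (Config × (Plane × ℝ)) × (Plane × ℝ) => (w.1.2, w.2.1) := by
      fun_prop
    exact hm (measurableSet_mem_zone d Rcs Rtx)
  have h := Kernel.measurable_kernel_prodMk_left
    (κ := configKernel.comap (Prod.fst : Config × (Plane × ℝ) → Config) measurable_fst) hS
  simp only [Kernel.comap_apply] at h
  exact h

/-- Points of `φ` which are retained in the presence of the additional pair `p`. -/
def survivors (p : Plane × ℝ) (φ : Config) : Set (Plane × ℝ) :=
  {q | p.1 ∉ zone d Rcs Rtx q.1 q.2 ∧ configKernel φ (zonePoints d Rcs Rtx q) ≤ 1}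

theorem measurableSet_survivors_joint :
    MeasurableSet {w : ((Plane × ℝ) × Config) × (Plane × ℝ) |
      w.2 ∈ survivors d Rcs Rtx w.1.1 w.1.2} := by
  have h1 : MeasurableSet {w : ((Plane × ℝ) × Config) × (Plane × ℝ) |
      w.1.1.1 ∈ zone d Rcs Rtx w.2.1 w.2.2} := by
    have hm : Measurable fun w : ((Plane × ℝ) × Config) × (Plane × ℝ) => (w.2, w.1.1.1) := by
      fun_prop
    exact hm (measurableSet_mem_zone d Rcs Rtx)
  have h2 : Measurable fun w : ((Plane × ℝ) × Config) × (Plane × ℝ) =>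
      configKernel w.1.2 (zonePoints d Rcs Rtx w.2) := by
    have hm : Measurable fun w : ((Plane × ℝ) × Config) × (Plane × ℝ) => (w.1.2, w.2) := by
      fun_prop
    have h := (measurable_zoneCount d Rcs Rtx).comp hm
    simp only [Function.comp_def] at h
    exact h
  have heq : {w : ((Plane × ℝ) × Config) × (Plane × ℝ) |
      w.2 ∈ survivors d Rcs Rtx w.1.1 w.1.2} =
      {w : ((Plane × ℝ) × Config) × (Plane × ℝ) | w.1.1.1 ∈ zone d Rcs Rtx w.2.1 w.2.2}ᶜ ∩
      {w : ((Plane × ℝ) × Config) × (Plane × ℝ) |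
        configKernel w.1.2 (zonePoints d Rcs Rtx w.2) ≤ 1} := by
    ext w
    simp only [survivors, mem_inter_iff, mem_compl_iff, mem_ofPred_eq]
  rw [heq]
  exact h1.compl.inter (measurableSet_le h2 measurable_const)

theorem measurableSet_survivors (p : Plane × ℝ) (φ : Config) :
    MeasurableSet (survivors d Rcs Rtx p φ) :=
  measurable_prodMk_left (measurableSet_survivors_joint d Rcs Rtx) (x := (p, φ))

/-- The retained points of `φ` in the presence of the additional pair `p`, translated so that `p`
sits at the origin. -/
noncomputable def survivorsSeenFrom (p : Plane × ℝ) (φ : Config) : Config :=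
  ((configKernel φ).restrict (survivors d Rcs Rtx p φ)).map fun q => (q.1 - p.1, q.2)

theorem measurable_survivorsSeenFrom :
    Measurable fun z : (Plane × ℝ) × Config => survivorsSeenFrom d Rcs Rtx z.1 z.2 := by
  refine Measure.measurable_of_measurable_coe _ fun A hA => ?_
  have hS : MeasurableSet {w : ((Plane × ℝ) × Config) × (Plane × ℝ) |
      (w.2.1 - w.1.1.1, w.2.2) ∈ A ∧ w.2 ∈ survivors d Rcs Rtx w.1.1 w.1.2} := by
    have hm : Measurable fun w : ((Plane × ℝ) × Config) × (Plane × ℝ) =>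
      (w.2.1 - w.1.1.1, w.2.2) := by fun_prop
    exact (hm hA).inter (measurableSet_survivors_joint d Rcs Rtx)
  have := Kernel.measurable_kernel_prodMk_left
    (κ := configKernel.comap (Prod.snd : (Plane × ℝ) × Config → Config) measurable_snd) hS
  simp only [Kernel.comap_apply] at this
  have heq : (fun z : (Plane × ℝ) × Config => survivorsSeenFrom d Rcs Rtx z.1 z.2 A) =
      fun z => configKernel z.2 (Prod.mk z ⁻¹' {w : ((Plane × ℝ) × Config) × (Plane × ℝ) |
        (w.2.1 - w.1.1.1, w.2.2) ∈ A ∧ w.2 ∈ survivors d Rcs Rtx w.1.1 w.1.2}) := by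
    funext z
    have hm : Measurable fun q : Plane × ℝ => (q.1 - z.1.1, q.2) := by fun_prop
    rw [survivorsSeenFrom, Measure.map_apply hm hA, Measure.restrict_apply (hm hA)]
    rfl
  rw [heq]
  exact this

variable {d Rcs Rtx}

theorem self_mem_zone (hRcs : 0 ≤ Rcs) (x : Plane) (θ : ℝ) : x ∈ zone d Rcs Rtx x θ :=
  Or.inl (Metric.mem_closedBall_self hRcs)

variable (d Rcs Rtx) in
/-- The pair of index `j` is retained in the presence of the additional pair `p`. -/
def KeptWith {ι : Type*} (p : Plane × ℝ) (q : ι → Plane × ℝ) (j : ι) : Prop :=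
  p.1 ∉ zone d Rcs Rtx (q j).1 (q j).2 ∧ ∀ k, k ≠ j → (q k).1 ∉ zone d Rcs Rtx (q j).1 (q j).2

/-- A transmitter lies in its own zone and always counts once, so the threshold for an otherwise
empty zone is `1` and not `0`. -/
theorem sum_dirac_zonePoints_le_one_iff {ι : Type*} (hRcs : 0 ≤ Rcs) (q : ι → Plane × ℝ) (j : ι) :
    Measure.sum (fun k => Measure.dirac (q k)) (zonePoints d Rcs Rtx (q j)) ≤ 1 ↔
      ∀ k, k ≠ j → (q k).1 ∉ zone d Rcs Rtx (q j).1 (q j).2 := by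
  classical
  have hj : q j ∈ zonePoints d Rcs Rtx (q j) := self_mem_zone hRcs _ _
  rw [sum_dirac_apply _ (measurableSet_zonePoints d Rcs Rtx _)]
  constructor
  · intro h k hk hmem
    have h2 : (2 : ℝ≥0∞) ≤ 1 := by
      refine le_trans ?_ ((ENNReal.sum_le_tsum {k, j}).trans h)
      rw [Finset.sum_pair hk, indicator_of_mem hj,
        indicator_of_mem (show q k ∈ zonePoints d Rcs Rtx (q j) from hmem)]
      norm_num
    norm_num at h2
  · intro h
    rw [tsum_eq_single j fun k hk => indicator_of_notMem
      (show q k ∉ zonePoints d Rcs Rtx (q j) from h k hk) _, indicator_of_mem hj]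
    rfl

open Classical in
theorem survivorsSeenFrom_sum_dirac {ι : Type*} (hRcs : 0 ≤ Rcs) (p : Plane × ℝ)
    (q : ι → Plane × ℝ) (hq : IsLocallyFinite (Measure.sum fun j => Measure.dirac (q j))) :
    survivorsSeenFrom d Rcs Rtx p (Measure.sum fun j => Measure.dirac (q j)) =
      Measure.sum fun j => if KeptWith d Rcs Rtx p q j then
        Measure.dirac ((q j).1 - p.1, (q j).2) else 0 := by
  have hm : Measurable fun q : Plane × ℝ => (q.1 - p.1, q.2) := by fun_prop
  ext A hA
  rw [survivorsSeenFrom, Measure.map_apply hm hA, Measure.restrict_apply (hm hA),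
    configKernel_apply hq,
    sum_dirac_apply _ ((hm hA).inter (measurableSet_survivors d Rcs Rtx p _)),
    Measure.sum_apply _ hA]
  refine tsum_congr fun j => ?_
  have hiff : q j ∈ survivors d Rcs Rtx p (Measure.sum fun j => Measure.dirac (q j)) ↔
      KeptWith d Rcs Rtx p q j := by
    simp only [survivors, mem_ofPred_eq, KeptWith, configKernel_apply hq,
      sum_dirac_zonePoints_le_one_iff hRcs]
  split_ifs with hk
  · rw [Measure.dirac_apply' _ hA]
    simp [indicator_apply, hiff, hk]
  · rw [indicator_of_notMem fun h => hk (hiff.1 h.2)]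
    rfl

end Zones

/-! ### The reduced Palm distributions -/

section Geometry

variable {d Rcs Rtx : ℝ}

theorem zone_angleMod (x : Plane) (t : ℝ) : zone d Rcs Rtx x (angleMod t) = zone d Rcs Rtx x t := by
  rw [zone, zone, receiver, receiver, polar_angleMod]

/-- The receiver of a moved pair is the moved receiver, since reducing the orientation modulo `2π`
does not affect its direction. As the motion is an isometry, zones move along with their pairs. -/
theorem mem_zone_moveTo_iff (p q : Plane × ℝ) (y : Plane) :
    rotation p.2 y + p.1 ∈ zone d Rcs Rtx (moveTo p q).1 (moveTo p q).2 ↔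
      y ∈ zone d Rcs Rtx q.1 q.2 := by
  have hr : receiver d (moveTo p q).1 (moveTo p q).2 = rotation p.2 (receiver d q.1 q.2) + p.1 := by
    have h1 : rotation p.2 (polar d q.2) = polar d (q.2 + p.2) := rotatePlane_polar _ _ _
    simp only [receiver, moveTo, map_add, h1]
    rw [polar_angleMod]
    abel
  have h2 : ∀ u v : Plane, dist (rotation p.2 u + p.1) (rotation p.2 v + p.1) = dist u v :=
    fun u v => by rw [dist_add_right, (rotation p.2).dist_map]
  simp only [zone, mem_union, Metric.mem_closedBall, hr, h2]
  simp only [moveTo, h2]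

theorem keptWith_moveTo_iff {ι : Type*} (p : Plane × ℝ) (q : ι → Plane × ℝ) (j : ι) :
    KeptWith d Rcs Rtx p (fun i => moveTo p (q i)) j ↔ KeptWith d Rcs Rtx 0 q j := by
  have h0 : p.1 = rotation p.2 0 + p.1 := by simp
  have h1 : ∀ k, (moveTo p (q k)).1 = rotation p.2 (q k).1 + p.1 := fun k => rfl
  unfold KeptWith
  rw [h0, mem_zone_moveTo_iff]
  simp only [h1]
  refine and_congr Iff.rfl (forall_congr' fun k => imp_congr Iff.rfl (not_congr ?_))
  exact mem_zone_moveTo_iff p (q j) (q k).1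

theorem moveTo_mem_zone_iff (p q : Plane × ℝ) :
    (moveTo p q).1 ∈ zone d Rcs Rtx p.1 p.2 ↔ q.1 ∈ zone d Rcs Rtx 0 0 := by
  have h := mem_zone_moveTo_iff (d := d) (Rcs := Rcs) (Rtx := Rtx) p (0, 0) q.1
  have h1 : (moveTo p (0, 0)).1 = p.1 := by simp [moveTo]
  have h2 : (moveTo p (0, 0)).2 = angleMod p.2 := by simp [moveTo]
  -- The moved origin pair carries the orientation of `p` reduced modulo `2π`; the zone is the same.
  rw [h1, h2, zone_angleMod] at h
  exact h

theorem retained_iff (x : ℕ → Plane) (t : ℕ → ℝ) (i : ℕ) :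
    Retained d Rcs Rtx x t i ↔ ∀ j, j ≠ i → x j ∉ zone d Rcs Rtx (x i) (t i) := by
  rw [Retained, encard_eq_zero, eq_empty_iff_forall_notMem]
  simp only [neighbors, mem_ofPred_eq, not_and]
  exact ⟨fun h j hj hm => h j hm hj, fun h j hm hj => h j hj hm⟩

theorem retained_iff_keptWith (q : ℕ → Plane × ℝ) {i j : ℕ} (hij : j ≠ i) :
    Retained d Rcs Rtx (fun k => (q k).1) (fun k => (q k).2) j ↔
      KeptWith d Rcs Rtx (q i) (fun k : ({i}ᶜ : Set ℕ) => q k) ⟨j, hij⟩ := by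
  rw [retained_iff, KeptWith]
  constructor
  · exact fun h => ⟨h i hij.symm, fun k hk => h k fun h' => hk (Subtype.ext h')⟩
  · rintro ⟨h1, h2⟩ k hk
    by_cases hki : k = i
    · exact hki ▸ h1
    · exact h2 ⟨k, hki⟩ fun h' => hk (congrArg Subtype.val h')

theorem isLocallyFinite_otherPoints {q : ℕ → Plane × ℝ} (hfin : IsLocallyFinite (allPoints q))
    (i : ℕ) : IsLocallyFinite (otherPoints q i) := by
  intro n
  refine lt_of_le_of_lt ?_ (hfin n)
  rw [otherPoints, allPoints, sum_dirac_apply (fun j : ({i}ᶜ : Set ℕ) => q j)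
    (measurableSet_annulus n), sum_dirac_apply _ (measurableSet_annulus n)]
  exact ENNReal.tsum_comp_le_tsum_of_injective Subtype.val_injective
    fun j => (annulus n).indicator (1 : Plane × ℝ → ℝ≥0∞) (q j)

-- Deleting a pair from the thinned process is not the same as thinning without it: the pair still
-- blocks others. Hence the survivors are computed in the presence of `q i`. Injectivity is needed
-- because `seenFrom` deletes the whole mass at `q i`, not just one index.
open Classical in
theorem seenFrom_thinned (hRcs : 0 ≤ Rcs) (q : ℕ → Plane × ℝ) (hq : Function.Injective q)
    (hfin : IsLocallyFinite (allPoints q)) (i : ℕ) :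
    seenFrom (q i) (Measure.sum fun j =>
      if Retained d Rcs Rtx (fun k => (q k).1) (fun k => (q k).2) j then
        Measure.dirac (q j) else 0) =
      survivorsSeenFrom d Rcs Rtx (q i) (otherPoints q i) := by
  have hfin' := isLocallyFinite_otherPoints hfin i
  rw [otherPoints, survivorsSeenFrom_sum_dirac hRcs (q i) (fun j : ({i}ᶜ : Set ℕ) => q j) hfin']
  have hm : Measurable fun z : Plane × ℝ => (z.1 - (q i).1, z.2) := by fun_prop
  ext A hA
  have hA' : MeasurableSet ((fun z : Plane × ℝ => (z.1 - (q i).1, z.2)) ⁻¹' A ∩ {q i}ᶜ) :=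
    (hm hA).inter (measurableSet_singleton _).compl
  rw [seenFrom, Measure.map_apply hm hA, Measure.restrict_apply (hm hA),
    Measure.sum_apply _ hA', Measure.sum_apply _ hA]
  set f : ℕ → ℝ≥0∞ := fun j =>
    (if Retained d Rcs Rtx (fun k => (q k).1) (fun k => (q k).2) j then
      Measure.dirac (q j) else 0) ((fun z : Plane × ℝ => (z.1 - (q i).1, z.2)) ⁻¹' A ∩ {q i}ᶜ)
  have hsub : ∑' j, f j = ∑' j : ({i}ᶜ : Set ℕ), f j := by
    rw [tsum_subtype]
    refine tsum_congr fun j => ?_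
    by_cases hj : j = i
    · subst hj
      rw [indicator_of_notMem (by simp)]
      simp only [f]
      split_ifs
      · rw [Measure.dirac_apply' _ hA', indicator_of_notMem (by simp)]
      · rfl
    · rw [indicator_of_mem (by simpa using hj)]
  change ∑' j, f j = _
  rw [hsub]
  refine tsum_congr fun j => ?_
  have hji : (j : ℕ) ≠ i := j.2
  have hiff := retained_iff_keptWith (d := d) (Rcs := Rcs) (Rtx := Rtx) q hji
  simp only [f]
  by_cases hk : KeptWith d Rcs Rtx (q i) (fun k : ({i}ᶜ : Set ℕ) => q k) j
  · rw [if_pos (hiff.2 hk), if_pos hk, Measure.dirac_apply' _ hA', Measure.dirac_apply' _ hA]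
    have hne : q j ≠ q i := fun h => hji (hq h)
    simp [indicator_apply, hne]
  · rw [if_neg fun h => hk (hiff.1 h), if_neg hk]
    rfl

open Classical in
/-- The retained points of `q` in the presence of the pair at the origin with orientation `0`,
rotated by `θ`. -/
noncomputable def palmConfig (d Rcs Rtx θ : ℝ) (q : ℕ → Plane × ℝ) : Config :=
  Measure.sum fun j => if KeptWith d Rcs Rtx 0 q j then Measure.dirac (rotatePair θ (q j)) else 0

theorem survivorsSeenFrom_moveTo (hRcs : 0 ≤ Rcs) (p : Plane × ℝ) (q : ℕ → Plane × ℝ)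
    (hfin : IsLocallyFinite (allPoints fun i => moveTo p (q i))) :
    survivorsSeenFrom d Rcs Rtx p (allPoints fun i => moveTo p (q i)) =
      palmConfig d Rcs Rtx p.2 q := by
  classical
  rw [allPoints, survivorsSeenFrom_sum_dirac hRcs p _ hfin, palmConfig]
  congr 1
  funext j
  have : ((moveTo p (q j)).1 - p.1, (moveTo p (q j)).2) = rotatePair p.2 (q j) := by
    simp only [moveTo, add_sub_cancel_right]
    rfl
  simp only [keptWith_moveTo_iff, this]

theorem palmConfig_apply (θ : ℝ) (q : ℕ → Plane × ℝ) {A : Set (Plane × ℝ)}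
    (hA : MeasurableSet A) : palmConfig d Rcs Rtx θ q A =
      ∑' j, {j | KeptWith d Rcs Rtx 0 q j ∧ rotatePair θ (q j) ∈ A}.indicator 1 j := by
  classical
  rw [palmConfig, Measure.sum_apply _ hA]
  refine tsum_congr fun j => ?_
  split_ifs with h
  · rw [Measure.dirac_apply' _ hA]
    simp [indicator_apply, h]
  · rw [indicator_of_notMem fun h' => h h'.1]
    rfl

theorem measurable_rotatePair_right (θ : ℝ) : Measurable (rotatePair θ) := by
  have h := measurable_rotatePair.comp (measurable_prodMk_left (x := θ) (β := Plane × ℝ))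
  simp only [Function.comp_def] at h
  exact h

/-- Rotation by `0` is not the identity, as it reduces orientations modulo `2π`. This absorption
makes the covariance of `palmConfig` exact and not merely almost sure. -/
theorem rotatePair_rotatePair_zero (θ : ℝ) (p : Plane × ℝ) :
    rotatePair θ (rotatePair 0 p) = rotatePair θ p := by
  simp only [rotatePair_eq, rotatePlane_rotatePlane, angleMod_add_angleMod, add_zero]

theorem palmConfig_map (θ : ℝ) (q : ℕ → Plane × ℝ) :
    (palmConfig d Rcs Rtx 0 q).map (rotatePair θ) = palmConfig d Rcs Rtx θ q := by
  ext A hA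
  have hm := measurable_rotatePair_right θ
  rw [Measure.map_apply hm hA, palmConfig_apply _ _ (hm hA), palmConfig_apply _ _ hA]
  simp only [mem_preimage, rotatePair_rotatePair_zero]

/-- The configuration functional `1{p is retained, the rest is seen in Y}`. -/
def retainedSeenIn (d Rcs Rtx : ℝ) (Y : Set Config) : Set ((Plane × ℝ) × Config) :=
  {z | configKernel z.2 (zonePoints d Rcs Rtx z.1) = 0 ∧ survivorsSeenFrom d Rcs Rtx z.1 z.2 ∈ Y}

theorem measurableSet_retainedSeenIn {Y : Set Config} (hY : MeasurableSet Y) :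
    MeasurableSet (retainedSeenIn d Rcs Rtx Y) := by
  have h1 := (measurable_zoneCount d Rcs Rtx).comp
    (measurable_snd.prodMk measurable_fst : Measurable fun z : (Plane × ℝ) × Config => (z.2, z.1))
  simp only [Function.comp_def] at h1
  exact (measurableSet_eq_fun h1 measurable_const).inter (measurable_survivorsSeenFrom d Rcs Rtx hY)

theorem thinned_apply_eq_tsum {Ω : Type*} {X : ℕ → Ω → Plane} {Θ : ℕ → Ω → ℝ}
    (hRcs : 0 ≤ Rcs) {ω : Ω}
    (hinj : Function.Injective fun i => (X i ω, Θ i ω))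
    (hfin : IsLocallyFinite (allPoints fun i => (X i ω, Θ i ω))) (B : Set Plane) (L : Set ℝ)
    (Y : Set Config) :
    thinned d Rcs Rtx X Θ ω
      {p | p.1 ∈ B ∧ p.2 ∈ L ∧ seenFrom p (thinned d Rcs Rtx X Θ ω) ∈ Y} =
      ∑' i, ((B ×ˢ L) ×ˢ univ ∩ retainedSeenIn d Rcs Rtx Y).indicator (1 : (Plane × ℝ) × Config → ℝ≥0∞)
        ((X i ω, Θ i ω), otherPoints (fun j => (X j ω, Θ j ω)) i) := by
  classical
  have hseen : ∀ i, seenFrom (X i ω, Θ i ω) (thinned d Rcs Rtx X Θ ω) =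
      survivorsSeenFrom d Rcs Rtx (X i ω, Θ i ω) (otherPoints (fun j => (X j ω, Θ j ω)) i) :=
    fun i => seenFrom_thinned hRcs (fun i => (X i ω, Θ i ω)) hinj hfin i
  -- Countability of the sum and measurability of singletons allow evaluation on the set at hand
  -- without proving it measurable.
  rw [thinned, Measure.sum_apply_of_countable]
  refine tsum_congr fun i => ?_
  have hfin' := isLocallyFinite_otherPoints hfin i
  have hret : Retained d Rcs Rtx (fun j => X j ω) (fun j => Θ j ω) i ↔
      configKernel (otherPoints (fun j => (X j ω, Θ j ω)) i)
        (zonePoints d Rcs Rtx (X i ω, Θ i ω)) = 0 := by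
    rw [configKernel_apply hfin', otherPoints_eq_zero_iff _ _ (measurableSet_zonePoints _ _ _ _),
      retained_iff]
    rfl
  have hiff : ((X i ω, Θ i ω), otherPoints (fun j => (X j ω, Θ j ω)) i) ∈
      ((B ×ˢ L) ×ˢ univ ∩ retainedSeenIn d Rcs Rtx Y) ↔
      (Retained d Rcs Rtx (fun j => X j ω) (fun j => Θ j ω) i ∧ X i ω ∈ B ∧ Θ i ω ∈ L ∧
        seenFrom (X i ω, Θ i ω) (thinned d Rcs Rtx X Θ ω) ∈ Y) := by
    rw [hret, hseen]
    simp only [retainedSeenIn, mem_inter_iff, mem_prod, mem_univ, and_true, mem_ofPred_eq]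
    tauto
  rw [indicator_apply]
  simp only [hiff]
  by_cases h : Retained d Rcs Rtx (fun j => X j ω) (fun j => Θ j ω) i
  · rw [if_pos h, Measure.dirac_apply]
    simp only [indicator_apply, mem_ofPred_eq, h, true_and]
    rfl
  · rw [if_neg h, if_neg fun h' => h h'.1]
    rfl

theorem SatisfiesMecke.lintegral_tsum {E Ω : Type*} [MeasurableSpace E] [MeasurableSpace Ω]
    {P : Measure Ω} {ν : Measure E} {p : ℕ → Ω → E} (h : SatisfiesMecke P ν p)
    (hp : ∀ i, Measurable (p i)) {F : E × Measure E → ℝ≥0∞} (hF : Measurable F) :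
    ∫⁻ ω, ∑' i, F (p i ω, otherPoints (fun j => p j ω) i) ∂P =
      ∫⁻ x, ∫⁻ ω, F (x, allPoints fun j => p j ω) ∂P ∂ν := by
  rw [← h F hF]
  exact MeasureTheory.lintegral_tsum fun i =>
    (hF.comp ((hp i).prodMk (measurable_otherPoints hp i))).aemeasurable

end Geometry

/-! ### Campbell formula of the thinned process -/

section Thinned

variable {Ω : Type*} [MeasurableSpace Ω] {P : Measure Ω} {lamp d Rcs Rtx : ℝ}
  {X : ℕ → Ω → Plane} {Θ : ℕ → Ω → ℝ}

theorem measurableSet_mem_zone_pair {q : ℕ → Ω → Plane × ℝ} (hq : ∀ i, Measurable (q i))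
    (i j : ℕ) : MeasurableSet {ω | (q i ω).1 ∈ zone d Rcs Rtx (q j ω).1 (q j ω).2} :=
  ((hq j).prodMk (hq i).fst) (measurableSet_mem_zone d Rcs Rtx)

theorem measurableSet_forall_ne_notMem_zone {q : ℕ → Ω → Plane × ℝ} (hq : ∀ i, Measurable (q i))
    (j : ℕ) : MeasurableSet
      {ω | ∀ k, k ≠ j → (q k ω).1 ∉ zone d Rcs Rtx (q j ω).1 (q j ω).2} := by
  have : {ω | ∀ k, k ≠ j → (q k ω).1 ∉ zone d Rcs Rtx (q j ω).1 (q j ω).2} =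
      ⋂ k, ⋂ (_ : k ≠ j), {ω | (q k ω).1 ∈ zone d Rcs Rtx (q j ω).1 (q j ω).2}ᶜ := by
    ext ω; simp
  rw [this]
  exact MeasurableSet.iInter fun k => MeasurableSet.iInter fun _ =>
    (measurableSet_mem_zone_pair hq k j).compl

theorem measurableSet_keptWith {q : ℕ → Ω → Plane × ℝ} (hq : ∀ i, Measurable (q i)) (j : ℕ) :
    MeasurableSet {ω | KeptWith d Rcs Rtx 0 (fun i => q i ω) j} := by
  have h1 : MeasurableSet {ω | (0 : Plane × ℝ).1 ∈ zone d Rcs Rtx (q j ω).1 (q j ω).2} :=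
    ((hq j).prodMk measurable_const) (measurableSet_mem_zone d Rcs Rtx)
  exact h1.compl.inter (measurableSet_forall_ne_notMem_zone hq j)

theorem measurable_palmConfig {q : ℕ → Ω → Plane × ℝ} (hq : ∀ i, Measurable (q i)) :
    Measurable fun z : ℝ × Ω => palmConfig d Rcs Rtx z.1 fun i => q i z.2 := by
  refine Measure.measurable_of_measurable_coe _ fun A hA => ?_
  simp_rw [palmConfig_apply _ _ hA]
  refine Measurable.tsum fun j => ?_
  have hS : MeasurableSet {z : ℝ × Ω | KeptWith d Rcs Rtx 0 (fun i => q i z.2) j ∧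
      rotatePair z.1 (q j z.2) ∈ A} := by
    have h1 : MeasurableSet {z : ℝ × Ω | KeptWith d Rcs Rtx 0 (fun i => q i z.2) j} :=
      measurable_snd (measurableSet_keptWith hq j)
    have h2 := measurable_rotatePair.comp
      (measurable_fst.prodMk ((hq j).comp measurable_snd) :
        Measurable fun z : ℝ × Ω => (z.1, q j z.2))
    simp only [Function.comp_def] at h2
    exact h1.inter (h2 hA)
  exact measurable_one.indicator hS

theorem lintegral_annulus_lt_top (hX : IsPoissonBipolar P lamp X Θ) (n : ℕ) :
    ∫⁻ ω, allPoints (fun i => (X i ω, Θ i ω)) (annulus n) ∂P < ∞ := by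
  set B : Set Plane := {y | ⌊‖y‖⌋₊ = n}
  have hB : MeasurableSet B := by
    have : Measurable fun y : Plane => ⌊‖y‖⌋₊ := Nat.measurable_floor.comp (by fun_prop)
    exact this (measurableSet_singleton n)
  have hBfin : volume B < ∞ := by
    refine (measure_mono (t := Metric.ball (0 : Plane) (n + 1)) fun y hy => ?_).trans_lt
      measure_ball_lt_top
    have h := Nat.lt_floor_add_one ‖y‖
    rw [show ⌊‖y‖⌋₊ = n from hy] at h
    simpa using h
  have h : ∀ ω, allPoints (fun i => (X i ω, Θ i ω)) (annulus n) = allPoints (fun i => X i ω) B := by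
    intro ω
    rw [allPoints, sum_dirac_apply _ (measurableSet_annulus n), allPoints, sum_dirac_apply _ hB]
    rfl
  simp_rw [h]
  rw [poisson_lintegral_count hX.poisson hB hBfin]
  exact ENNReal.mul_lt_top ENNReal.ofReal_lt_top hBfin

theorem bipolar_ae_isLocallyFinite (hX : IsPoissonBipolar P lamp X Θ) :
    ∀ᵐ ω ∂P, IsLocallyFinite (allPoints fun i => (X i ω, Θ i ω)) :=
  ae_all_iff.2 fun n => ae_lt_top ((Measure.measurable_coe (measurableSet_annulus n)).comp
    (measurable_allPoints (measurable_pair hX))) (lintegral_annulus_lt_top hX n).ne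

/-- Void probability of the exclusion zone of the typical pair, for points of intensity `lamp`. -/
theorem bipolar_void_set (hlamp : 0 < lamp) (hX : IsPoissonBipolar P lamp X Θ) {B : Set Plane}
    (hB : MeasurableSet B) (hfin : volume B < ∞) :
    P {ω | ∀ j, X j ω ∉ B} = ENNReal.ofReal (Real.exp (-lamp * volume.real B)) := by
  have h : {ω | ∀ j, X j ω ∉ B} = {ω | allPoints (fun i => X i ω) B = 0} := by
    ext ω
    exact (allPoints_eq_zero_iff _ hB).symm
  rw [h, poisson_void hX.poisson hB hfin, ENNReal.toReal_mul, ENNReal.toReal_ofReal hlamp.le,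
    neg_mul]
  rfl

theorem volume_zone_lt_top (d Rcs Rtx : ℝ) (x : Plane) (θ : ℝ) :
    volume (zone d Rcs Rtx x θ) < ∞ :=
  measure_union_lt_top measure_closedBall_lt_top measure_closedBall_lt_top

/-- The event that the exclusion zone of the pair at the origin with orientation `0` is empty. -/
def originRetained (d Rcs Rtx : ℝ) (X : ℕ → Ω → Plane) : Set Ω :=
  {ω | ∀ j, X j ω ∉ zone d Rcs Rtx 0 0}

theorem measurableSet_originRetained (hX : ∀ i, Measurable (X i)) :
    MeasurableSet (originRetained d Rcs Rtx X) := by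
  have : originRetained d Rcs Rtx X = ⋂ j, X j ⁻¹' (zone d Rcs Rtx 0 0)ᶜ := by
    ext ω; simp [originRetained]
  rw [this]
  exact MeasurableSet.iInter fun j => hX j (measurableSet_zone d Rcs Rtx 0 0).compl

theorem measure_originRetained (hlamp : 0 < lamp) (hX : IsPoissonBipolar P lamp X Θ) :
    P (originRetained d Rcs Rtx X) =
      ENNReal.ofReal (Real.exp (-lamp * volume.real (zone d Rcs Rtx 0 0))) :=
  bipolar_void_set hlamp hX (measurableSet_zone d Rcs Rtx 0 0) (volume_zone_lt_top _ _ _ _ _)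

variable [IsProbabilityMeasure P]

/-- By invariance under rigid motions, the environment of an additional pair at `p` is a rotation
of the environment of an additional pair at the origin. -/
theorem measure_retainedSeenIn (hRcs : 0 ≤ Rcs) (hX : IsPoissonBipolar P lamp X Θ)
    (p : Plane × ℝ) {Y : Set Config} (hY : MeasurableSet Y) :
    P {ω | (p, allPoints fun i => (X i ω, Θ i ω)) ∈ retainedSeenIn d Rcs Rtx Y} =
      P (originRetained d Rcs Rtx X ∩
        {ω | palmConfig d Rcs Rtx p.2 (fun i => (X i ω, Θ i ω)) ∈ Y}) := by
  have hK : MeasurableSet {φ : Config | (p, φ) ∈ retainedSeenIn d Rcs Rtx Y} :=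
    measurable_prodMk_left (measurableSet_retainedSeenIn hY)
  have hX' := isPoissonBipolar_moveTo hX p
  -- Replacing the process by its image under the motion that carries the origin pair to `p` leaves
  -- the law unchanged, and for the moved points the event becomes one about the origin.
  have h := congrArg (fun m => m {φ : Config | (p, φ) ∈ retainedSeenIn d Rcs Rtx Y})
    (bipolar_law_moveTo hX p)
  rw [Measure.map_apply (measurable_allPoints (measurable_pair hX')) hK,
    Measure.map_apply (measurable_allPoints (measurable_pair hX)) hK] at h
  refine h.symm.trans (measure_congr ?_)
  filter_upwards [bipolar_ae_isLocallyFinite hX'] with ω hω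
  refine propext ?_
  change (configKernel _ _ = 0 ∧ survivorsSeenFrom _ _ _ _ _ ∈ Y) ↔ (_ ∧ _)
  refine and_congr ?_ ?_
  · rw [configKernel_apply hω, allPoints_eq_zero_iff _ (measurableSet_zonePoints d Rcs Rtx p)]
    exact forall_congr' fun j => not_congr (moveTo_mem_zone_iff p (X j ω, Θ j ω))
  · rw [survivorsSeenFrom_moveTo hRcs p (fun i => (X i ω, Θ i ω)) hω]
    rfl

/-- The Campbell formula of the thinned process. -/
theorem lintegral_thinned (hlamp : 0 < lamp) (hRcs : 0 ≤ Rcs) (hX : IsPoissonBipolar P lamp X Θ)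
    {B : Set Plane} {L : Set ℝ} {Y : Set Config} (hB : MeasurableSet B) (hL : MeasurableSet L)
    (hY : MeasurableSet Y) :
    ∫⁻ ω, thinned d Rcs Rtx X Θ ω
      {p | p.1 ∈ B ∧ p.2 ∈ L ∧ seenFrom p (thinned d Rcs Rtx X Θ ω) ∈ Y} ∂P =
      ENNReal.ofReal lamp * volume B * ∫⁻ θ in L, P (originRetained d Rcs Rtx X ∩
        {ω | palmConfig d Rcs Rtx θ (fun i => (X i ω, Θ i ω)) ∈ Y}) ∂markLaw := by
  have hS : MeasurableSet ((B ×ˢ L) ×ˢ univ ∩ retainedSeenIn d Rcs Rtx Y) :=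
    ((hB.prod hL).prod MeasurableSet.univ).inter (measurableSet_retainedSeenIn hY)
  have hpair := measurable_pair hX
  have h1 : ∫⁻ ω, thinned d Rcs Rtx X Θ ω
      {p | p.1 ∈ B ∧ p.2 ∈ L ∧ seenFrom p (thinned d Rcs Rtx X Θ ω) ∈ Y} ∂P =
      ∫⁻ ω, ∑' i, ((B ×ˢ L) ×ˢ univ ∩ retainedSeenIn d Rcs Rtx Y).indicator (1 : (Plane × ℝ) × Config → ℝ≥0∞)
        ((X i ω, Θ i ω), otherPoints (fun j => (X j ω, Θ j ω)) i) ∂P := by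
    refine lintegral_congr_ae ?_
    filter_upwards [bipolar_ae_injective hX, bipolar_ae_isLocallyFinite hX] with ω hinj hfin
    exact thinned_apply_eq_tsum hRcs hinj hfin B L Y
  rw [h1]
  -- First use of the Mecke formula: `p` becomes a deterministic pair added to the process.
  refine ((bipolar_satisfiesMecke hlamp hX).lintegral_tsum hpair
    (measurable_one.indicator hS)).trans ?_
  have h2 : ∀ p : Plane × ℝ, ∫⁻ ω, ((B ×ˢ L) ×ˢ univ ∩ retainedSeenIn d Rcs Rtx Y).indicator
      (1 : (Plane × ℝ) × Config → ℝ≥0∞) (p, allPoints fun j => (X j ω, Θ j ω)) ∂P =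
      B.indicator 1 p.1 * L.indicator (fun θ => P (originRetained d Rcs Rtx X ∩
        {ω | palmConfig d Rcs Rtx θ (fun i => (X i ω, Θ i ω)) ∈ Y})) p.2 := by
    intro p
    have hK : MeasurableSet
        {ω | (p, allPoints fun i => (X i ω, Θ i ω)) ∈ retainedSeenIn d Rcs Rtx Y} :=
      (measurable_const.prodMk (measurable_allPoints hpair)) (measurableSet_retainedSeenIn hY)
    by_cases hp : p ∈ B ×ˢ L
    · rw [indicator_of_mem hp.1, indicator_of_mem hp.2, Pi.one_apply, one_mul,
        ← measure_retainedSeenIn hRcs hX p hY, ← lintegral_indicator_one hK]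
      refine lintegral_congr fun ω => ?_
      have hp1 : p.1 ∈ B := hp.1
      have hp2 : p.2 ∈ L := hp.2
      classical
      simp [indicator_apply, mem_prod, hp1, hp2]
    · have h0 : ∀ ω, ((B ×ˢ L) ×ˢ univ ∩ retainedSeenIn d Rcs Rtx Y).indicator
          (1 : (Plane × ℝ) × Config → ℝ≥0∞) (p, allPoints fun j => (X j ω, Θ j ω)) = 0 := fun ω =>
        indicator_of_notMem (fun h => hp h.1.1) _
      refine ((lintegral_congr h0).trans lintegral_zero).trans ?_
      by_cases hpB : p.1 ∈ B
      · rw [indicator_of_notMem (s := L) fun h => hp ⟨hpB, h⟩, mul_zero]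
      · rw [indicator_of_notMem hpB, zero_mul]
  have hmθ : Measurable fun θ => P (originRetained d Rcs Rtx X ∩
      {ω | palmConfig d Rcs Rtx θ (fun i => (X i ω, Θ i ω)) ∈ Y}) := by
    have hT : MeasurableSet {z : ℝ × Ω | z.2 ∈ originRetained d Rcs Rtx X ∧
        palmConfig d Rcs Rtx z.1 (fun i => (X i z.2, Θ i z.2)) ∈ Y} :=
      (measurable_snd (measurableSet_originRetained hX.poisson.measurable)).inter
        (measurable_palmConfig hpair hY)
    exact measurable_measure_prodMk_left hT
  simp_rw [h2]
  rw [bipolarIntensity, lintegral_prod_mul (measurable_one.indicator hB).aemeasurable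
    (hmθ.indicator hL).aemeasurable, lintegral_indicator_one hB, lintegral_indicator hL]
  rfl

end Thinned

/-! ### The intensity and a covariant Palm family -/

section Palm

variable {Ω : Type*} [MeasurableSpace Ω] {P : Measure Ω}
  {lamp d Rcs Rtx : ℝ} {X : ℕ → Ω → Plane} {Θ : ℕ → Ω → ℝ}

/-- The law of the rotated environment of a retained pair at the origin. -/
noncomputable def palmKernel (d Rcs Rtx : ℝ) (hX : IsPoissonBipolar P lamp X Θ) :
    Kernel ℝ Config where
  toFun θ := (ProbabilityTheory.cond P (originRetained d Rcs Rtx X)).map fun ω =>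
    palmConfig d Rcs Rtx θ fun i => (X i ω, Θ i ω)
  measurable' := by
    have hm := measurable_palmConfig (d := d) (Rcs := Rcs) (Rtx := Rtx) (measurable_pair hX)
    refine Measure.measurable_of_measurable_coe _ fun Y hY => ?_
    have h : ∀ θ, ((ProbabilityTheory.cond P (originRetained d Rcs Rtx X)).map fun ω =>
        palmConfig d Rcs Rtx θ fun i => (X i ω, Θ i ω)) Y =
        ProbabilityTheory.cond P (originRetained d Rcs Rtx X) (Prod.mk θ ⁻¹'
          ((fun z : ℝ × Ω => palmConfig d Rcs Rtx z.1 fun i => (X i z.2, Θ i z.2)) ⁻¹' Y)) :=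
      fun θ => Measure.map_apply (hm.comp measurable_prodMk_left) hY
    simp_rw [h]
    exact measurable_measure_prodMk_left (hm hY)

theorem palmKernel_apply (hX : IsPoissonBipolar P lamp X Θ) (θ : ℝ) :
    palmKernel d Rcs Rtx hX θ =
      (ProbabilityTheory.cond P (originRetained d Rcs Rtx X)).map fun ω =>
        palmConfig d Rcs Rtx θ fun i => (X i ω, Θ i ω) := rfl

theorem measurable_palmConfig_right (hX : IsPoissonBipolar P lamp X Θ) (θ : ℝ) :
    Measurable fun ω => palmConfig d Rcs Rtx θ fun i => (X i ω, Θ i ω) := by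
  have h := (measurable_palmConfig (d := d) (Rcs := Rcs) (Rtx := Rtx) (measurable_pair hX)).comp
    (measurable_prodMk_left (x := θ) (β := Ω))
  simp only [Function.comp_def] at h
  exact h

theorem measure_originRetained_ne_zero (hlamp : 0 < lamp) (hX : IsPoissonBipolar P lamp X Θ) :
    P (originRetained d Rcs Rtx X) ≠ 0 := by
  rw [measure_originRetained hlamp hX]
  simp [Real.exp_pos]

theorem isMarkovKernel_palmKernel [IsProbabilityMeasure P] (hlamp : 0 < lamp) (hX : IsPoissonBipolar P lamp X Θ) :
    IsMarkovKernel (palmKernel d Rcs Rtx hX) := by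
  refine ⟨fun θ => ?_⟩
  have := cond_isProbabilityMeasure
    (measure_originRetained_ne_zero (d := d) (Rcs := Rcs) (Rtx := Rtx) hlamp hX)
  rw [palmKernel_apply]
  exact Measure.isProbabilityMeasure_map (measurable_palmConfig_right hX θ).aemeasurable

theorem measure_originRetained_mul_palmKernel [IsProbabilityMeasure P] (hlamp : 0 < lamp)
    (hX : IsPoissonBipolar P lamp X Θ) (θ : ℝ) {Y : Set Config} (hY : MeasurableSet Y) :
    P (originRetained d Rcs Rtx X) * palmKernel d Rcs Rtx hX θ Y =
      P (originRetained d Rcs Rtx X ∩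
        {ω | palmConfig d Rcs Rtx θ (fun i => (X i ω, Θ i ω)) ∈ Y}) := by
  have h0 := measure_originRetained_ne_zero (d := d) (Rcs := Rcs) (Rtx := Rtx) hlamp hX
  rw [palmKernel_apply, Measure.map_apply (measurable_palmConfig_right hX θ) hY,
    cond_apply (measurableSet_originRetained hX.poisson.measurable), ← mul_assoc,
    ENNReal.mul_inv_cancel h0 (measure_ne_top _ _), one_mul]
  rfl

/-- The intensity of the process of retained pairs. -/
noncomputable def thinnedIntensity (lamp d Rcs Rtx : ℝ) : ℝ :=
  lamp * Real.exp (-lamp * volume.real (zone d Rcs Rtx 0 0))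

theorem thinnedIntensity_pos (hlamp : 0 < lamp) : 0 < thinnedIntensity lamp d Rcs Rtx :=
  mul_pos hlamp (Real.exp_pos _)

theorem setLIntegral_markLaw {L : Set ℝ} (hL : MeasurableSet L) (f : ℝ → ℝ≥0∞) :
    ∫⁻ θ in L, f θ ∂markLaw =
      (ENNReal.ofReal (2 * Real.pi))⁻¹ * ∫⁻ θ in L ∩ Icc 0 (2 * Real.pi), f θ := by
  rw [markLaw_eq, Measure.restrict_smul, Measure.restrict_restrict hL, lintegral_smul_measure,
    smul_eq_mul]

/-- The Campbell formula contains the joint probability that the origin is retained and its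
environment lies in `Y`. Writing it as a conditional law times the retention probability, that last
factor and `lamp` combine into the intensity, while `1 / 2π` comes from the density of the marks. -/
theorem isReducedPalm_palmKernel [IsProbabilityMeasure P] (hlamp : 0 < lamp) (hRcs : 0 ≤ Rcs)
    (hX : IsPoissonBipolar P lamp X Θ) :
    IsReducedPalm P (thinned d Rcs Rtx X Θ) (thinnedIntensity lamp d Rcs Rtx)
      (palmKernel d Rcs Rtx hX) := by
  refine ⟨isMarkovKernel_palmKernel hlamp hX, fun B L Y hB hL hY => ?_⟩
  rw [lintegral_thinned hlamp hRcs hX hB hL hY]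
  simp_rw [← measure_originRetained_mul_palmKernel hlamp hX _ hY]
  rw [lintegral_const_mul _ (Kernel.measurable_coe _ hY), setLIntegral_markLaw hL,
    measure_originRetained hlamp hX, thinnedIntensity,
    ENNReal.ofReal_div_of_pos Real.two_pi_pos, ENNReal.ofReal_mul hlamp.le, div_eq_mul_inv]
  ring

theorem hasIntensity_of_isReducedPalm {Ψ : Ω → Config} {lam : ℝ} (hlam : 0 < lam)
    {Q : Kernel ℝ Config} (h : IsReducedPalm P Ψ lam Q) : HasIntensity P Ψ lam := by
  intro B hB
  have := h.1
  have h1 := h.2 B univ univ hB MeasurableSet.univ MeasurableSet.univ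
  simp only [measure_univ, lintegral_one, univ_inter, Measure.restrict_apply_univ,
    Real.volume_Icc, sub_zero] at h1
  have h2 : ENNReal.ofReal lam =
      ENNReal.ofReal (lam / (2 * Real.pi)) * ENNReal.ofReal (2 * Real.pi) := by
    rw [← ENNReal.ofReal_mul (by positivity), div_mul_cancel₀ _ Real.two_pi_pos.ne']
  rw [h2, mul_right_comm, ← h1]
  refine lintegral_congr fun ω => ?_
  congr 1
  ext p
  simp

theorem rotationCovariant_palmKernel (hX : IsPoissonBipolar P lamp X Θ) :
    RotationCovariant (palmKernel d Rcs Rtx hX) := by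
  intro θ _
  rw [palmKernel_apply, palmKernel_apply,
    Measure.map_map (Measure.measurable_map _ (measurable_rotatePair_right θ))
      (measurable_palmConfig_right hX 0)]
  congr 1
  funext ω
  exact (palmConfig_map θ _).symm

theorem norm_rotatePlane (α : ℝ) (y : Plane) : ‖rotatePlane α y‖ = ‖y‖ :=
  (rotation α).norm_map y

/-- Mean numbers of points in bounded regions are finite under the Palm distributions. -/
theorem lintegral_palmKernel_annulus_lt_top (hlamp : 0 < lamp)
    (hX : IsPoissonBipolar P lamp X Θ) (θ : ℝ) (n : ℕ) :
    ∫⁻ μ, μ (annulus n) ∂(palmKernel d Rcs Rtx hX θ) < ∞ := by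
  have h0 := measure_originRetained_ne_zero (d := d) (Rcs := Rcs) (Rtx := Rtx) hlamp hX
  rw [palmKernel_apply, lintegral_map (Measure.measurable_coe (measurableSet_annulus n))
    (measurable_palmConfig_right hX θ), ProbabilityTheory.cond, lintegral_smul_measure]
  refine ENNReal.mul_lt_top (ENNReal.inv_lt_top.2 (pos_iff_ne_zero.2 h0)) ?_
  refine (setLIntegral_le_lintegral _ _).trans_lt ?_
  -- Rotation preserves annuli, so the survivors in an annulus are at most as many as the original
  -- points there.
  refine lt_of_le_of_lt (lintegral_mono fun ω => ?_) (lintegral_annulus_lt_top hX n)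
  rw [palmConfig_apply _ _ (measurableSet_annulus n), allPoints,
    sum_dirac_apply _ (measurableSet_annulus n)]
  refine ENNReal.tsum_le_tsum fun j => ?_
  by_cases h : rotatePair θ (X j ω, Θ j ω) ∈ annulus n
  · have h' : (X j ω, Θ j ω) ∈ annulus n := by
      rw [rotatePair_eq, annulus, mem_ofPred_eq, norm_rotatePlane] at h
      exact h
    rw [indicator_of_mem h']
    exact indicator_le_self _ _ _
  · rw [indicator_of_notMem fun h' => h h'.2]
    exact zero_le

end Palm

/-! ### Uniqueness of the mean measures of the Palm distributions -/

section Uniqueness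

variable {Ω : Type*} [MeasurableSpace Ω] {P : Measure Ω} {Ψ : Ω → Config} {lam : ℝ}
  {Q Q' : Kernel ℝ Config}

theorem IsReducedPalm.bind_eq (hlam : 0 < lam) (hQ : IsReducedPalm P Ψ lam Q)
    (hQ' : IsReducedPalm P Ψ lam Q') {L : Set ℝ} (hL : MeasurableSet L) :
    (volume.restrict (L ∩ Icc 0 (2 * Real.pi))).bind Q =
      (volume.restrict (L ∩ Icc 0 (2 * Real.pi))).bind Q' := by
  ext Y hY
  rw [Measure.bind_apply hY Q.aemeasurable, Measure.bind_apply hY Q'.aemeasurable]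
  have h := (hQ.2 (Metric.ball 0 1) L Y measurableSet_ball hL hY).symm.trans
    (hQ'.2 (Metric.ball 0 1) L Y measurableSet_ball hL hY)
  -- The unit ball as test region has positive finite area, so the common prefactor cancels.
  refine (ENNReal.mul_right_inj ?_ ?_).1 h
  · refine mul_ne_zero ?_ (Metric.measure_ball_pos volume 0 one_pos).ne'
    simp only [ne_eq, ENNReal.ofReal_eq_zero, not_le]
    positivity
  · exact ENNReal.mul_ne_top ENNReal.ofReal_ne_top measure_ball_lt_top.ne

theorem IsReducedPalm.ae_lintegral_eq (hlam : 0 < lam) (hQ : IsReducedPalm P Ψ lam Q)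
    (hQ' : IsReducedPalm P Ψ lam Q') {f : Config → ℝ≥0∞} (hf : Measurable f) :
    ∀ᵐ θ ∂(volume.restrict (Icc 0 (2 * Real.pi))), ∫⁻ μ, f μ ∂(Q θ) = ∫⁻ μ, f μ ∂(Q' θ) := by
  refine ae_eq_of_forall_setLIntegral_eq_of_sigmaFinite hf.lintegral_kernel hf.lintegral_kernel
    fun L hL _ => ?_
  rw [Measure.restrict_restrict hL, ← Measure.lintegral_bind Q.aemeasurable hf.aemeasurable,
    ← Measure.lintegral_bind Q'.aemeasurable hf.aemeasurable, hQ.bind_eq hlam hQ' hL]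

/-- For each test function the means agree outside a null set of orientations that may depend on it.
A mean measure finite on the annuli is determined by its values on a countable generating algebra
intersected with annuli, so one null set suffices. -/
theorem IsReducedPalm.ae_join_eq (hlam : 0 < lam) (hQ : IsReducedPalm P Ψ lam Q)
    (hQ' : IsReducedPalm P Ψ lam Q') (hfin : ∀ θ n, ∫⁻ μ, μ (annulus n) ∂(Q' θ) < ∞) :
    ∀ᵐ θ ∂(volume.restrict (Icc 0 (2 * Real.pi))), (Q θ).join = (Q' θ).join := by
  set S := generateSetAlgebra (MeasurableSpace.countableGeneratingSet (Plane × ℝ)) with hS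
  have hSc : S.Countable :=
    countable_generateSetAlgebra (MeasurableSpace.countable_countableGeneratingSet)
  have hgen : MeasurableSpace.generateFrom S = (inferInstance : MeasurableSpace (Plane × ℝ)) := by
    rw [hS, generateFrom_generateSetAlgebra_eq, MeasurableSpace.generateFrom_countableGeneratingSet]
  have hSm : ∀ A ∈ S, MeasurableSet A := fun A hA => by
    have := MeasurableSpace.measurableSet_generateFrom hA
    rwa [hgen] at this
  have hpi : IsPiSystem S := isSetAlgebra_generateSetAlgebra.isSetRing.isSetSemiring.isPiSystem
  have h1 : ∀ᵐ θ ∂(volume.restrict (Icc 0 (2 * Real.pi))), ∀ A ∈ S, ∀ n,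
      ∫⁻ μ, μ (A ∩ annulus n) ∂(Q θ) = ∫⁻ μ, μ (A ∩ annulus n) ∂(Q' θ) := by
    refine (ae_ball_iff hSc).2 fun A hA => ae_all_iff.2 fun n => ?_
    exact hQ.ae_lintegral_eq hlam hQ'
      (Measure.measurable_coe ((hSm A hA).inter (measurableSet_annulus n)))
  have h2 : ∀ᵐ θ ∂(volume.restrict (Icc 0 (2 * Real.pi))), ∀ n,
      ∫⁻ μ, μ (annulus n) ∂(Q θ) = ∫⁻ μ, μ (annulus n) ∂(Q' θ) :=
    ae_all_iff.2 fun n => hQ.ae_lintegral_eq hlam hQ' (Measure.measurable_coe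
      (measurableSet_annulus n))
  filter_upwards [h1, h2] with θ h1 h2
  refine (Measure.ext_of_generateFrom_of_cover (S := S) (T := range annulus) hgen.symm
    (countable_range _) hpi (by rw [sUnion_range, iUnion_annulus]) ?_ ?_ ?_).symm
  · rintro _ ⟨n, rfl⟩
    rw [Measure.join_apply (measurableSet_annulus n)]
    exact (hfin θ n).ne
  · rintro _ ⟨n, rfl⟩ A hA
    have hm := (hSm A hA).inter (measurableSet_annulus n)
    rw [Measure.join_apply hm, Measure.join_apply hm, h1 A hA n]
  · rintro _ ⟨n, rfl⟩
    rw [Measure.join_apply (measurableSet_annulus n), Measure.join_apply (measurableSet_annulus n),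
      h2 n]

/-- Interference is linear in the configuration, so its mean sees only the mean measure. -/
theorem meanInterference_eq_lintegral_join (d Pt : ℝ) {l : ℝ → ℝ} (hl : Measurable l)
    (Q : Kernel ℝ Config) (θ : ℝ) :
    meanInterference d Pt l Q θ =
      ∫⁻ p, ENNReal.ofReal (Pt * l (dist p.1 (receiver d 0 θ))) ∂(Q θ).join := by
  rw [Measure.lintegral_join (by fun_prop)]
  rfl

/-- The mean interference under a rotation covariant family does not depend on the orientation. -/
theorem meanInterference_of_rotationCovariant (d Pt : ℝ) {l : ℝ → ℝ} (hl : Measurable l)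
    {Q : Kernel ℝ Config} (hQ : RotationCovariant Q) {θ : ℝ} (hθ : θ ∈ Ico 0 (2 * Real.pi)) :
    meanInterference d Pt l Q θ = meanInterference d Pt l Q 0 := by
  have hg : ∀ z : Plane, Measurable fun p : Plane × ℝ => ENNReal.ofReal (Pt * l (dist p.1 z)) :=
    fun z => by fun_prop
  have hrot := measurable_rotatePair_right θ
  have hi : Measurable (interference Pt l (receiver d 0 θ)) := Measure.measurable_lintegral (hg _)
  rw [meanInterference, hQ θ hθ, lintegral_map hi (Measure.measurable_map _ hrot),
    meanInterference]
  refine lintegral_congr fun μ => ?_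
  rw [interference, lintegral_map (hg _) hrot, interference]
  refine lintegral_congr fun p => ?_
  have h1 : receiver d 0 θ = rotatePlane θ (receiver d 0 0) := by
    rw [receiver, receiver, zero_add, zero_add, rotatePlane_polar, zero_add]
  have h2 : dist (rotatePlane θ p.1) (rotatePlane θ (receiver d 0 0)) =
      dist p.1 (receiver d 0 0) := (rotation θ).dist_map _ _
  rw [rotatePair_eq, h1, h2]

end Uniqueness

/-! ### Integration in polar coordinates -/

theorem polar_periodic (r : ℝ) : Function.Periodic (polar r) (2 * Real.pi) := fun φ => by
  simp [polar]

/-- The standard polar chart uses angles in `(-π, π)`; periodicity moves the integral to `[0, 2π]`.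
-/
theorem lintegral_plane_polar {H : Plane → ℝ≥0∞} (hH : Measurable H) :
    ∫⁻ y, H y = ∫⁻ r in Ioi (0 : ℝ), ∫⁻ φ in Icc 0 (2 * Real.pi),
      ENNReal.ofReal r * H (polar r φ) := by
  set e : Plane → ℝ × ℝ := fun y => MeasurableEquiv.finTwoArrow (WithLp.ofLp y)
  have he : MeasurePreserving e volume volume :=
    (volume_preserving_finTwoArrow ℝ).comp (PiLp.volume_preserving_ofLp (Fin 2))
  set G : ℝ × ℝ → ℝ≥0∞ := fun z => H !₂[z.1, z.2]
  have hG : Measurable G := hH.comp (by fun_prop)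
  have h1 : ∫⁻ y, H y = ∫⁻ z, G z := by
    rw [← he.lintegral_comp hG]
    refine lintegral_congr fun y => ?_
    simp only [G, e]
    congr 1
    ext i
    fin_cases i <;> rfl
  have hpol : Measurable fun z : ℝ × ℝ => polar z.1 z.2 := by
    unfold polar
    fun_prop
  rw [h1, ← lintegral_comp_polarCoord_symm, polarCoord_target, Measure.volume_eq_prod,
    ← Measure.prod_restrict, lintegral_prod _ (by
      refine Measurable.aemeasurable ?_
      simp only [smul_eq_mul]
      refine (by fun_prop : Measurable fun z : ℝ × ℝ => ENNReal.ofReal z.1).mul ?_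
      exact hH.comp hpol)]
  refine lintegral_congr fun r => ?_
  have hper : Function.Periodic (fun φ => ENNReal.ofReal r * H (polar r φ)) (2 * Real.pi) :=
    fun φ => by simp only [polar_periodic r φ]
  rw [setLIntegral_Icc_of_periodic hper (-Real.pi),
    show -Real.pi + 2 * Real.pi = Real.pi by ring, setLIntegral_congr Ioo_ae_eq_Ioc]
  rfl

/-! ### The mean interference under the Palm distribution at the origin -/

section Formula

variable {d Rcs Rtx : ℝ}

theorem dist_polar_receiver (d r φ : ℝ) :
    dist (polar r φ) (receiver d 0 0) =
      Real.sqrt (r ^ 2 - 2 * r * d * Real.cos φ + d ^ 2) := by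
  rw [EuclideanSpace.dist_eq]
  congr 1
  simp only [receiver, polar, Fin.sum_univ_two, Real.dist_eq, sq_abs]
  have := Real.sin_sq_add_cos_sq φ
  simp
  linear_combination r ^ 2 * this

theorem dist_zero_receiver_polar (d r φ θ : ℝ) :
    dist 0 (receiver d (polar r φ) θ) =
      Real.sqrt (r ^ 2 + 2 * r * d * Real.cos (φ - θ) + d ^ 2) := by
  rw [EuclideanSpace.dist_eq]
  congr 1
  simp only [receiver, polar, Fin.sum_univ_two, Real.dist_eq, sq_abs, Real.cos_sub]
  have h1 := Real.sin_sq_add_cos_sq φ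
  have h2 := Real.sin_sq_add_cos_sq θ
  simp
  linear_combination r ^ 2 * h1 + d ^ 2 * h2

theorem dist_polar_zero {r : ℝ} (hr : 0 ≤ r) (φ : ℝ) : dist (polar r φ) 0 = r := by
  rw [EuclideanSpace.dist_eq]
  simp only [polar, Fin.sum_univ_two, Real.dist_eq, sq_abs]
  have h1 := Real.sin_sq_add_cos_sq φ
  simp
  rw [Real.sqrt_eq_iff_eq_sq (by positivity) hr]
  linear_combination r ^ 2 * h1

/-- Four disc conditions become three sets: the two carrier sensing conditions coincide, both being
a bound on the distance `r` between the transmitters. -/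
theorem compatible_iff (hRtx : 0 < Rtx) {r : ℝ} (hr : 0 ≤ r) (φ θ : ℝ) :
    (polar r φ ∉ zone d Rcs Rtx 0 0 ∧ (0 : Plane) ∉ zone d Rcs Rtx (polar r φ) θ) ↔
      (r, φ, θ) ∉ S₁ Rcs ∪ S₂ d Rtx ∪ S₃ d Rtx := by
  simp only [zone, mem_union, Metric.mem_closedBall, dist_polar_receiver, dist_zero_receiver_polar,
    dist_comm (0 : Plane) (polar r φ), dist_polar_zero hr, Real.sqrt_le_left hRtx.le, S₁, S₂, S₃,
    mem_ofPred_eq]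
  tauto

variable {Ω : Type*} [MeasurableSpace Ω] {P : Measure Ω} {lamp : ℝ}
  {X : ℕ → Ω → Plane} {Θ : ℕ → Ω → ℝ}

variable (d Rcs Rtx) in
/-- Configurations `z.2` to which both the pair `z.1` and the pair at the origin with orientation
`0` can be added so that the two are retained. -/
def jointlyRetained : Set ((Plane × ℝ) × Config) :=
  {z | (z.1.1 ∉ zone d Rcs Rtx 0 0 ∧ (0 : Plane) ∉ zone d Rcs Rtx z.1.1 z.1.2) ∧
    configKernel z.2 (zonePoints d Rcs Rtx z.1) = 0 ∧
      configKernel z.2 (zonePoints d Rcs Rtx 0) = 0}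

theorem measurableSet_jointlyRetained : MeasurableSet (jointlyRetained d Rcs Rtx) := by
  have h1 : MeasurableSet {z : (Plane × ℝ) × Config | z.1.1 ∈ zone d Rcs Rtx 0 0} :=
    measurable_fst.fst (measurableSet_zone d Rcs Rtx 0 0)
  have h2 : MeasurableSet {z : (Plane × ℝ) × Config |
      (0 : Plane) ∈ zone d Rcs Rtx z.1.1 z.1.2} :=
    (measurable_fst.prodMk measurable_const : Measurable
      fun z : (Plane × ℝ) × Config => (z.1, (0 : Plane))) (measurableSet_mem_zone d Rcs Rtx)
  have h3 := (measurable_zoneCount d Rcs Rtx).comp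
    (measurable_snd.prodMk measurable_fst : Measurable fun z : (Plane × ℝ) × Config => (z.2, z.1))
  have h4 := (measurable_zoneCount d Rcs Rtx).comp
    (measurable_snd.prodMk measurable_const : Measurable
      fun z : (Plane × ℝ) × Config => (z.2, (0 : Plane × ℝ)))
  simp only [Function.comp_def] at h3 h4
  exact (h1.compl.inter h2.compl).inter
    ((measurableSet_eq_fun h3 measurable_const).inter (measurableSet_eq_fun h4 measurable_const))

theorem mem_jointlyRetained_iff {q : ℕ → Plane × ℝ} (hfin : IsLocallyFinite (allPoints q)) (j : ℕ) :
    (q j, otherPoints q j) ∈ jointlyRetained d Rcs Rtx ↔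
      (∀ i, (q i).1 ∉ zone d Rcs Rtx 0 0) ∧ KeptWith d Rcs Rtx 0 q j := by
  simp only [jointlyRetained, mem_ofPred_eq,
    configKernel_apply (isLocallyFinite_otherPoints hfin j),
    otherPoints_eq_zero_iff _ _ (measurableSet_zonePoints _ _ _ _), KeptWith]
  constructor
  · rintro ⟨⟨h1, h2⟩, h3, h4⟩
    refine ⟨fun i => ?_, h2, h3⟩
    by_cases hi : i = j
    · exact hi ▸ h1
    · exact h4 i hi
  · rintro ⟨h1, h2, h3⟩
    exact ⟨⟨h1 j, h2⟩, h3, fun i _ => h1 i⟩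

theorem interference_palmConfig {Pt : ℝ} {l : ℝ → ℝ} (hl : Measurable l) (z : Plane)
    (q : ℕ → Plane × ℝ) : interference Pt l z (palmConfig d Rcs Rtx 0 q) =
      ∑' j, {j | KeptWith d Rcs Rtx 0 q j}.indicator
        (fun j => ENNReal.ofReal (Pt * l (dist (q j).1 z))) j := by
  classical
  have hg : Measurable fun p : Plane × ℝ => ENNReal.ofReal (Pt * l (dist p.1 z)) := by fun_prop
  rw [interference, palmConfig, lintegral_sum_measure]
  refine tsum_congr fun j => ?_
  split_ifs with h
  · rw [lintegral_dirac' _ hg, indicator_of_mem (show j ∈ {j | KeptWith d Rcs Rtx 0 q j} from h),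
      rotatePair_eq, rotatePlane_zero]
  · rw [indicator_of_notMem (show j ∉ {j | KeptWith d Rcs Rtx 0 q j} from h), lintegral_zero_measure]

/-- For compatible pairs, both are retained exactly when the other points avoid the union of their
zones, whose void probability is known; otherwise the event is empty. -/
theorem measure_jointlyRetained (hlamp : 0 < lamp) (hX : IsPoissonBipolar P lamp X Θ) (y : Plane)
    (t : ℝ) :
    P {ω | ((y, t), allPoints fun i => (X i ω, Θ i ω)) ∈ jointlyRetained d Rcs Rtx} =
      {z : Plane × ℝ | z.1 ∉ zone d Rcs Rtx 0 0 ∧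
        (0 : Plane) ∉ zone d Rcs Rtx z.1 z.2}.indicator (fun z => ENNReal.ofReal (Real.exp
          (-lamp * volume.real (zone d Rcs Rtx 0 0 ∪ zone d Rcs Rtx z.1 z.2)))) (y, t) := by
  classical
  rw [indicator_apply]
  split_ifs with h
  · rw [← bipolar_void_set hlamp hX ((measurableSet_zone d Rcs Rtx 0 0).union
      (measurableSet_zone d Rcs Rtx y t))
      (measure_union_lt_top (volume_zone_lt_top _ _ _ _ _) (volume_zone_lt_top _ _ _ _ _))]
    refine measure_congr ?_
    filter_upwards [bipolar_ae_isLocallyFinite hX] with ω hω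
    refine propext ?_
    change (_ ∧ _) ↔ _
    rw [configKernel_apply hω, allPoints_eq_zero_iff _ (measurableSet_zonePoints d Rcs Rtx _),
      allPoints_eq_zero_iff _ (measurableSet_zonePoints d Rcs Rtx _)]
    constructor
    · rintro ⟨-, h1, h2⟩ j (hj | hj)
      · exact h2 j hj
      · exact h1 j hj
    · exact fun h' => ⟨h, fun j hj => h' j (Or.inr hj), fun j hj => h' j (Or.inl hj)⟩
  · have : {ω | ((y, t), allPoints fun i => (X i ω, Θ i ω)) ∈ jointlyRetained d Rcs Rtx} = ∅ := by
      ext ω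
      simp only [mem_ofPred_eq, mem_empty_iff_false, iff_false]
      exact fun h' => h h'.1
    rw [this, measure_empty]

variable [IsProbabilityMeasure P]

/-- Conditioning contributes the inverse retention probability. On the event that the origin is
retained, the interference is a sum over kept points `j`, and the two requirements together form a
condition on point `j` and the remaining configuration. -/
theorem meanInterference_palmKernel_eq_lintegral (hlamp : 0 < lamp)
    (hX : IsPoissonBipolar P lamp X Θ) (Pt : ℝ) {l : ℝ → ℝ} (hl : Measurable l) :
    meanInterference d Pt l (palmKernel d Rcs Rtx hX) 0 =
      (P (originRetained d Rcs Rtx X))⁻¹ * ∫⁻ p : Plane × ℝ,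
        ENNReal.ofReal (Pt * l (dist p.1 (receiver d 0 0))) *
          P {ω | (p, allPoints fun i => (X i ω, Θ i ω)) ∈ jointlyRetained d Rcs Rtx}
        ∂(bipolarIntensity lamp) := by
  classical
  set g : Plane × ℝ → ℝ≥0∞ := fun p => ENNReal.ofReal (Pt * l (dist p.1 (receiver d 0 0)))
  have hg : Measurable g := by fun_prop
  have hpair := measurable_pair hX
  have hi : Measurable (interference Pt l (receiver d 0 0)) := Measure.measurable_lintegral hg
  set F : (Plane × ℝ) × Config → ℝ≥0∞ :=
    fun z => g z.1 * (jointlyRetained d Rcs Rtx).indicator 1 z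
  have hF : Measurable F :=
    (hg.comp measurable_fst).mul (measurable_one.indicator measurableSet_jointlyRetained)
  rw [meanInterference, palmKernel_apply, lintegral_map hi (measurable_palmConfig_right hX 0),
    ProbabilityTheory.cond, lintegral_smul_measure, smul_eq_mul]
  congr 1
  rw [← lintegral_indicator (measurableSet_originRetained hX.poisson.measurable)]
  have h1 : ∫⁻ ω, (originRetained d Rcs Rtx X).indicator (fun ω => interference Pt l
      (receiver d 0 0) (palmConfig d Rcs Rtx 0 fun i => (X i ω, Θ i ω))) ω ∂P =
      ∫⁻ ω, ∑' j, F ((X j ω, Θ j ω), otherPoints (fun i => (X i ω, Θ i ω)) j) ∂P := by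
    refine lintegral_congr_ae ?_
    filter_upwards [bipolar_ae_isLocallyFinite hX] with ω hω
    have hiff := mem_jointlyRetained_iff (d := d) (Rcs := Rcs) (Rtx := Rtx) hω
    by_cases ho : ω ∈ originRetained d Rcs Rtx X
    · rw [indicator_of_mem ho, interference_palmConfig hl]
      refine tsum_congr fun j => ?_
      have ho' : ∀ i, X i ω ∉ zone d Rcs Rtx 0 0 := ho
      by_cases hk : KeptWith d Rcs Rtx 0 (fun i => (X i ω, Θ i ω)) j
      · rw [indicator_of_mem (show j ∈ {j | KeptWith d Rcs Rtx 0
          (fun i => (X i ω, Θ i ω)) j} from hk)]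
        simp only [F]
        rw [indicator_of_mem ((hiff j).2 ⟨ho', hk⟩), Pi.one_apply, mul_one]
      · rw [indicator_of_notMem (show j ∉ {j | KeptWith d Rcs Rtx 0
          (fun i => (X i ω, Θ i ω)) j} from hk)]
        simp only [F]
        rw [indicator_of_notMem fun h => hk ((hiff j).1 h).2, mul_zero]
    · rw [indicator_of_notMem ho]
      refine (ENNReal.tsum_eq_zero.2 fun j => ?_).symm
      simp only [F]
      rw [indicator_of_notMem fun h => ho ((hiff j).1 h).1, mul_zero]
  rw [h1]
  -- Second use of the Mecke formula, now for the interfering pair.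
  refine ((bipolar_satisfiesMecke hlamp hX).lintegral_tsum hpair hF).trans ?_
  refine lintegral_congr fun p => ?_
  have hK : MeasurableSet
      {ω | (p, allPoints fun i => (X i ω, Θ i ω)) ∈ jointlyRetained d Rcs Rtx} :=
    (measurable_const.prodMk (measurable_allPoints hpair)) measurableSet_jointlyRetained
  rw [← lintegral_indicator_one hK, ← lintegral_const_mul _ (measurable_one.indicator hK)]
  rfl

/-- The mean interference of the typical pair. -/
theorem meanInterference_palmKernel (hlamp : 0 < lamp) (hRtx : 0 < Rtx)
    (hX : IsPoissonBipolar P lamp X Θ) {Pt : ℝ} (hPt : 0 < Pt) {l : ℝ → ℝ} (hl : Measurable l)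
    (hl_nonneg : ∀ r, 0 ≤ r → 0 ≤ l r) :
    meanInterference d Pt l (palmKernel d Rcs Rtx hX) 0 =
      interferenceFormula lamp (thinnedIntensity lamp d Rcs Rtx) d Rcs Rtx Pt l := by
  set h : Plane × ℝ → ℝ≥0∞ := fun p => ENNReal.ofReal (Pt * l (dist p.1 (receiver d 0 0))) *
    P {ω | (p, allPoints fun i => (X i ω, Θ i ω)) ∈ jointlyRetained d Rcs Rtx} with hh
  have hpair := measurable_pair hX
  have hm : Measurable h := by
    refine Measurable.mul (by fun_prop) ?_
    have hT : MeasurableSet {z : (Plane × ℝ) × Ω | (z.1, allPoints fun i => (X i z.2, Θ i z.2)) ∈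
        jointlyRetained d Rcs Rtx} :=
      (measurable_fst.prodMk ((measurable_allPoints hpair).comp measurable_snd))
        measurableSet_jointlyRetained
    exact measurable_measure_prodMk_left hT
  have hval : ∀ r, 0 < r → ∀ φ t, ENNReal.ofReal r * h (polar r φ, t) =
      ENNReal.ofReal Pt * ENNReal.ofReal
        (l (Real.sqrt (r ^ 2 - 2 * r * d * Real.cos φ + d ^ 2)) * k lamp d Rcs Rtx r φ t * r) := by
    intro r hr φ t
    have hl0 := hl_nonneg _ (Real.sqrt_nonneg (r ^ 2 - 2 * r * d * Real.cos φ + d ^ 2))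
    simp only [hh]
    rw [measure_jointlyRetained hlamp hX, dist_polar_receiver]
    by_cases hc : (r, φ, t) ∈ S₁ Rcs ∪ S₂ d Rtx ∪ S₃ d Rtx
    · rw [indicator_of_notMem (show (polar r φ, t) ∉ {z : Plane × ℝ | z.1 ∉ zone d Rcs Rtx 0 0 ∧
        (0 : Plane) ∉ zone d Rcs Rtx z.1 z.2} from
          fun h' => (compatible_iff hRtx hr.le φ t).1 h' hc), k, if_pos hc]
      simp
    · rw [indicator_of_mem (show (polar r φ, t) ∈ {z : Plane × ℝ | z.1 ∉ zone d Rcs Rtx 0 0 ∧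
        (0 : Plane) ∉ zone d Rcs Rtx z.1 z.2} from (compatible_iff hRtx hr.le φ t).2 hc), k,
        if_neg hc, ← ENNReal.ofReal_mul (by positivity), ← ENNReal.ofReal_mul hr.le,
        ← ENNReal.ofReal_mul hPt.le]
      congr 1
      rw [unionArea]
      ring
  rw [meanInterference_palmKernel_eq_lintegral hlamp hX Pt hl]
  change _ * ∫⁻ p, h p ∂(bipolarIntensity lamp) = _
  have hm2 : Measurable fun y => ∫⁻ t, h (y, t) ∂markLaw := hm.lintegral_prod_right'
  rw [bipolarIntensity, lintegral_prod _ hm.aemeasurable, lintegral_smul_measure, smul_eq_mul,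
    lintegral_plane_polar hm2, interferenceFormula]
  have hinner : ∀ r ∈ Ioi (0 : ℝ), ∫⁻ φ in Icc 0 (2 * Real.pi),
      ENNReal.ofReal r * ∫⁻ t, h (polar r φ, t) ∂markLaw =
      (ENNReal.ofReal (2 * Real.pi))⁻¹ * ENNReal.ofReal Pt * ∫⁻ φ in Icc 0 (2 * Real.pi),
        ∫⁻ t in Icc 0 (2 * Real.pi), ENNReal.ofReal
          (l (Real.sqrt (r ^ 2 - 2 * r * d * Real.cos φ + d ^ 2)) *
            k lamp d Rcs Rtx r φ t * r) := by
    intro r hr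
    rw [← lintegral_const_mul' _ _ (ENNReal.mul_ne_top
      (ENNReal.inv_ne_top.2 (by simp [Real.pi_pos])) ENNReal.ofReal_ne_top)]
    refine lintegral_congr fun φ => ?_
    rw [← lintegral_const_mul' _ _ ENNReal.ofReal_ne_top, lintegral_markLaw]
    simp_rw [hval r hr φ]
    rw [lintegral_const_mul' _ _ ENNReal.ofReal_ne_top]
    exact (mul_assoc _ _ _).symm
  rw [setLIntegral_congr_fun measurableSet_Ioi hinner, lintegral_const_mul' _ _
    (ENNReal.mul_ne_top (ENNReal.inv_ne_top.2 (by simp [Real.pi_pos])) ENNReal.ofReal_ne_top),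
    ← mul_assoc, ← mul_assoc]
  congr 1
  -- The prefactor is `lamp * Pt / (2π)` divided by the retention probability; as the intensity is
  -- `lamp` times that probability, a second factor `lamp` appears in the numerator.
  have hE := Real.exp_pos (-lamp * volume.real (zone d Rcs Rtx 0 0))
  rw [measure_originRetained hlamp hX, thinnedIntensity, ← ENNReal.ofReal_inv_of_pos hE,
    ← ENNReal.ofReal_inv_of_pos Real.two_pi_pos, ← ENNReal.ofReal_mul (by positivity),
    ← ENNReal.ofReal_mul (by positivity), ← ENNReal.ofReal_mul (by positivity)]
  congr 1
  field_simp

end Formula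

end RtsCts

/-! ### The theorem on the mean interference -/

open RtsCts
theorem theorem1 {Ω : Type*} [MeasurableSpace Ω] (P : Measure Ω) [IsProbabilityMeasure P]
    (lamp d Rcs Rtx Pt : ℝ) (hlamp : 0 < lamp) (hd : 0 < d) (hRtx : 0 < Rtx) (hRcs : Rtx < Rcs)
    (hPt : 0 < Pt) (l : ℝ → ℝ) (hl : Measurable l) (hl_nonneg : ∀ r, 0 ≤ r → 0 ≤ l r)
    (X : ℕ → Ω → Plane) (Θ : ℕ → Ω → ℝ) (hX : IsPoissonBipolar P lamp X Θ) :
    ∃ lam : ℝ, 0 < lam ∧ HasIntensity P (thinned d Rcs Rtx X Θ) lam ∧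
      (∃ Q : Kernel ℝ Config,
        IsReducedPalm P (thinned d Rcs Rtx X Θ) lam Q ∧ RotationCovariant Q) ∧
      ∀ Q : Kernel ℝ Config, IsReducedPalm P (thinned d Rcs Rtx X Θ) lam Q →
        (∀ᵐ θ ∂(volume.restrict (Icc 0 (2 * Real.pi))),
          meanInterference d Pt l Q θ = interferenceFormula lamp lam d Rcs Rtx Pt l) ∧
        (RotationCovariant Q → ∀ θ ∈ Ico 0 (2 * Real.pi),
          meanInterference d Pt l Q θ = interferenceFormula lamp lam d Rcs Rtx Pt l) := by
  have hRcs0 : 0 ≤ Rcs := (hRtx.trans hRcs).le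
  have hlam : 0 < thinnedIntensity lamp d Rcs Rtx := thinnedIntensity_pos hlamp
  have hpalm := isReducedPalm_palmKernel (d := d) (Rtx := Rtx) hlamp hRcs0 hX
  have hcov := rotationCovariant_palmKernel (d := d) (Rcs := Rcs) (Rtx := Rtx) hX
  refine ⟨thinnedIntensity lamp d Rcs Rtx, hlam, hasIntensity_of_isReducedPalm hlam hpalm,
    ⟨_, hpalm, hcov⟩, fun Q hQ => ?_⟩
  have hae : ∀ᵐ θ ∂(volume.restrict (Icc 0 (2 * Real.pi))), meanInterference d Pt l Q θ =
      interferenceFormula lamp (thinnedIntensity lamp d Rcs Rtx) d Rcs Rtx Pt l := by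
    -- Covariance is stated on the half-open period; the endpoint `2π` is negligible.
    have hIco : ∀ᵐ θ ∂(volume.restrict (Icc 0 (2 * Real.pi))), θ ∈ Ico 0 (2 * Real.pi) := by
      rw [← restrict_Ico_eq_restrict_Icc]
      exact ae_restrict_mem measurableSet_Ico
    filter_upwards [hQ.ae_join_eq hlam hpalm (lintegral_palmKernel_annulus_lt_top hlamp hX),
      hIco] with θ hθ hmem
    rw [meanInterference_eq_lintegral_join d Pt hl, hθ, ← meanInterference_eq_lintegral_join d Pt hl,
      meanInterference_of_rotationCovariant d Pt hl hcov hmem,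
      meanInterference_palmKernel hlamp hRtx hX hPt hl hl_nonneg]
  refine ⟨hae, fun hQcov θ hθ => ?_⟩
  have hne : (volume.restrict (Icc 0 (2 * Real.pi))) ≠ 0 := by
    rw [Ne, Measure.restrict_eq_zero, Real.volume_Icc]
    simp [Real.pi_pos]
  have : NeZero (volume.restrict (Icc 0 (2 * Real.pi))) := ⟨hne⟩
  have hIco : ∀ᵐ θ ∂(volume.restrict (Icc 0 (2 * Real.pi))), θ ∈ Ico 0 (2 * Real.pi) := by
    rw [← restrict_Ico_eq_restrict_Icc]
    exact ae_restrict_mem measurableSet_Ico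
  -- The period has positive length, so some `θ₀` in it has the right value; covariance carries this
  -- value to orientation `0` and from there to `θ`.
  obtain ⟨θ₀, h₀, hmem⟩ := (hae.and hIco).exists
  rw [meanInterference_of_rotationCovariant d Pt hl hQcov hθ,
    ← meanInterference_of_rotationCovariant d Pt hl hQcov hmem, h₀]
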